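/- **Setting.** Alice emits $N_{\rm em}$ blocks of three pulses. For the $i$th pulse of a block ($i=1,2,3$) she chooses a uniformly random bit $b_i\in\{0,1\}$ and prepares a state $\hat\rho^{b_i}_{S_i}$ of the light, such that (A2) the vacuum probability $\langle{\rm vac}|\hat\rho^{b}_{S_i}|{\rm vac}\rangle$ does not depend on $b$, and (A3) for every $\boldsymbol b=b_1b_2b_3$ and $n\in\{1,2,3\}$ the block $\bigotimes_{i=1}^3\hat\rho^{b_i}_{S_i}$ contains $n$ or more photons with probability at most $q_n$. Equivalently, Alice prepares for each block $\bigotimes_{i=1}^3\sum_{b_i}\hat H|b_i\rangle_{A_i}|\psi_{b_i}\rangle_{S_iR_i}/\sqrt2$, where $\hat H$ is the Hadamard operator and $|\psi_{b}\rangle_{S_iR_i}$ purifies $\hat\rho^{b}_{S_i}$; the purifications are chosen with equal vacuum components, $\langle{\rm vac}|_{S_i}|\psi_0\rangle_{S_iR_i}=\langle{\rm vac}|_{S_i}|\psi_1\rangle_{S_iR_i}$. Eve has no access to the systems $R_i$, keeps an arbitrary environment, and acts on all light jointly by an arbitrary channel. For each block Bob receives a system that either carries exactly one photon, in the space spanned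 by $|1\rangle_B$ (photon in pulse $(u,1)$, i.e. pulse 1 in the upper arm of the interferometer), $|2\rangle_B$ (photon in pulse 2 before the first beam splitter) and $|3\rangle_B$ (photon in pulse $(l,3)$, i.e. pulse 3 in the lower arm), in which case there is a detection event, or does not, in which case there is none. The beam splitters have transmittances $\eta_k\in[\tfrac12-\delta_k^{\rm(BS)},\tfrac12+\delta_k^{\rm(BS)}]$ with $0\le\delta_k^{\rm(BS)}<\tfrac12$; put $\eta_k^U=\tfrac12+\delta^{\rm(BS)}_k$, $k=1,2$. With $\hat P(|v\rangle)=|v\rangle\langle v|$, detector $D_d$ ($d=0,1$) clicks in time slot $j=1,2$ with POVM element $$\hat\Pi_{1,D_0}=\hat P(\sqrt{1-\eta_2}|1\rangle+\sqrt{\eta_1\eta_2}|2\rangle),\quad \hat\Pi_{1,D_1}=\hat P(\sqrt{\eta_2}|1\rangle-\sqrt{\eta_1(1-\eta_2)}|2\rangle),$$ $$\hat\Pi_{2,D_0}=\hat P(\sqrt{(1-\eta_2)(1-\eta_1)}|2\rangle+\sqrt{\eta_2}|3\rangle),\quad \hat\Pi_{2,D_1}=\hat P(\sqrt{\eta_2(1-\eta_1)}|2\rangle-\sqrt{1-\eta_2}|3\rangle).$$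 Each detection event is independently a code event with probability $t$ and a sample event with probability $1-t$, $0<t<1$. In a sample event a bit error is $b_j\oplus b_{j+1}\ne d$, where the bits $b$ are the $X$-basis outcomes of the qubits $A_1A_2A_3$. In a code event Bob measures instead in which of the two pulses $(u,j)$, $(l,j+1)$ the photon is before the second beam splitter, and Alice measures the $Z$-basis outcomes $z$ of her qubits; she predicts $z_j=1$ if $z_j\oplus z_{j+1}=1$ and the photon is in $(u,j)$, and $z_j=0$ otherwise, and a phase error is a wrong prediction of $z_j$. Let $N_{\det},N_{\rm code},N_{\rm sample},N_{\rm ph},N_{\rm bit}$ be the numbers of detection, code and sample events, of phase errors and of bit errors, and put $Q=N_{\det}/N_{\rm em}$, $e_{\rm bit}=N_{\rm bit}/N_{\rm sample}$, $e_{\rm ph}=N_{\rm ph}/N_{\rm code}$. **Theorem.** Every source satisfying (A2), (A3) admits purifications with equal vacuum components. In the asymptotic limit of large $N_{\det}$ the phase error rate is bounded by $$e_{\rm ph}^U=\lambda(\eta_1^U,\eta_2^U)\left(e_{\rm bit}+\frac{\sqrt{q_1q_3}}{Q}+2\delta_2^{\rm(BS)}\right)+\frac{q_2}{Q},$$ $$\lambda(\eta_1,\eta_2)=\frac{1-(1-\eta_1)\eta_2+\sqrt{[1-(1-\eta_1)\eta_2]^2-4\eta_1(1-\eta_1)(1-\eta_2)^2}}{2(1-\eta_1)(1-\eta_2)^2}.$$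 Precisely: for all $t$, $\delta_1^{\rm(BS)},\delta_2^{\rm(BS)}$, $q_1,q_2,q_3$ as above and all $\varepsilon,p>0$ there is an $m$ such that for all $\eta_1,\eta_2$ in their ranges, all sources and purifications as above, all $N_{\rm em}$ and all attacks of Eve, $$\Pr\left[N_{\det}\ge m\ \text{ and }\ e_{\rm ph}>e_{\rm ph}^U+\varepsilon\right]\le p .$$ -/

import Mathlib

open scoped ComplexConjugate Kronecker

noncomputable section

namespace DPS

/-! ### Alice's source

Each pulse lives in the bosonic Fock space of an arbitrary set `M` of optical modes, written as
`ℓ²` over the occupation numbers.  The three pulses of a block are indexed by `Fin 3`; Alice's bits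
are Booleans. -/

/-- Occupation numbers of the modes in `M`. The vacuum is `0`. -/
abbrev Occ (M : Type*) := M →₀ ℕ

/-- The Fock space of one pulse. -/
abbrev Fock (M : Type*) := lp (fun _ : Occ M => ℂ) 2

/-- Pulse together with the purifying system `R = ℓ²(K)` (every Hilbert space is of this form). -/
abbrev FockR (M K : Type*) := lp (fun _ : Occ M × K => ℂ) 2

open Classical in
/-- The matrix element `⟨s| ρ |s'⟩` in the occupation number basis. -/
def elem {M : Type*} (ρ : Fock M →L[ℂ] Fock M) (s s' : Occ M) : ℂ :=
  inner ℂ (lp.single 2 s (1 : ℂ) : Fock M) (ρ (lp.single 2 s' (1 : ℂ)))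

/-- Density operators: positive with trace one. -/
structure IsDensity {M : Type*} (ρ : Fock M →L[ℂ] Fock M) : Prop where
  positive : ρ.IsPositive
  trace_one : HasSum (fun s => elem ρ s s) 1

/-- The probability that the block `ρ₁^{b₁} ⊗ ρ₂^{b₂} ⊗ ρ₃^{b₃}` contains at least `n` photons. -/
def blockTail {M : Type*} (ρ : Fin 3 → Bool → (Fock M →L[ℂ] Fock M)) (b : Fin 3 → Bool) (n : ℕ) :
    ℝ :=
  ∑' s : Fin 3 → Occ M,
    if n ≤ ∑ i, (s i).degree then ∏ i, (elem (ρ i (b i)) (s i) (s i)).re else 0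

/-- The assumptions on Alice's device: `ρ i b` is the state of the `i`th pulse of a block for bit
`b`, the vacuum probability does not depend on the bit, and a block contains `n` or more photons
with probability at most `q n`, for `n = 1, 2, 3`. -/
structure IsSource {M : Type*} (ρ : Fin 3 → Bool → (Fock M →L[ℂ] Fock M)) (q : ℕ → ℝ) : Prop where
  density : ∀ i b, IsDensity (ρ i b)
  vacuum : ∀ i, elem (ρ i false) 0 0 = elem (ρ i true) 0 0
  tail : ∀ b n, 1 ≤ n → n ≤ 3 → blockTail ρ b n ≤ q n

/-- `ψ i b ∈ S_i ⊗ R_i` is a purification of `ρ i b` for all `i, b`, and `ψ i 0`, `ψ i 1` have the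
same vacuum component `(⟨vac| ⊗ 1) ψ i b ∈ R_i`. -/
structure IsPurification {M K : Type*} (ψ : Fin 3 → Bool → FockR M K)
    (ρ : Fin 3 → Bool → (Fock M →L[ℂ] Fock M)) : Prop where
  purifies : ∀ i b s s', HasSum (fun r => ψ i b (s, r) * conj (ψ i b (s', r))) (elem (ρ i b) s s')
  vacuum : ∀ i r, ψ i false (0, r) = ψ i true (0, r)

/-- Entries `⟨z| H |b⟩` of the Hadamard matrix. -/
def had (z b : Bool) : ℂ := (if z && b then -1 else 1) / (√2 : ℝ)

/-- The component of `∑_b (H|b⟩)_A |ψ_b⟩_{SR} / √2` on `|z⟩_A |s⟩_S |r⟩_R`. -/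
def pulseAmp {M K : Type*} (ψ : Bool → FockR M K) (z : Bool) (s : Occ M) (r : K) : ℂ :=
  ∑ b, had z b * ψ b (s, r) / (√2 : ℝ)

theorem summable_pi_prod {ι α : Type*} [Fintype ι] (f : ι → α → ℝ) (h0 : ∀ i a, 0 ≤ f i a)
    (hf : ∀ i, Summable (f i)) : Summable (fun s : ι → α => ∏ i, f i (s i)) := by
  classical
  refine summable_of_sum_le (c := ∏ i, ∑' a, f i a)
    (fun s => Finset.prod_nonneg fun i _ => h0 i (s i)) fun u => ?_
  calc ∑ s ∈ u, ∏ i, f i (s i)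
      ≤ ∑ s ∈ Fintype.piFinset (fun i => u.image (fun s => s i)), ∏ i, f i (s i) := by
        refine Finset.sum_le_sum_of_subset_of_nonneg (fun s hs => ?_)
          (fun s _ _ => Finset.prod_nonneg fun i _ => h0 i (s i))
        exact Fintype.mem_piFinset.2 fun i => Finset.mem_image_of_mem (fun s : ι → α => s i) hs
    _ = ∏ i, ∑ a ∈ u.image (fun s => s i), f i a := (Finset.prod_univ_sum _ _).symm
    _ ≤ ∏ i, ∑' a, f i a :=
        Finset.prod_le_prod (fun i _ => Finset.sum_nonneg fun a _ => h0 i a)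
          (fun i _ => (hf i).sum_le_tsum _ fun a _ => h0 i a)

theorem memℓp_pulseAmp {M K : Type*} (ψ : Bool → FockR M K) (z : Bool) (r : K) :
    Memℓp (fun s : Occ M => pulseAmp ψ z s r) 2 := by
  have key : ∀ b, Memℓp (fun s : Occ M => ψ b (s, r)) 2 := by
    intro b
    have h := (memℓp_gen_iff (by norm_num)).1 (lp.memℓp (ψ b))
    refine (memℓp_gen_iff (by norm_num)).2 ?_
    exact h.comp_injective (i := fun s : Occ M => (s, r)) fun s s' h => (Prod.mk.inj h).1
  have := ((key true).const_smul (had z true / (√2 : ℝ))).add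
    ((key false).const_smul (had z false / (√2 : ℝ)))
  convert this using 1
  funext s
  simp [pulseAmp]
  ring

/-- The state `⨂ |Φ⟩` of `N` blocks, for fixed basis vectors `z` of Alice's qubits and `r` of the
purifying systems: the (unnormalized) vector of the light `S` of all the blocks. -/
def blocksAmp {M K : Type*} (N : ℕ) (ψ : Fin 3 → Bool → FockR M K) (z : Fin N → Fin 3 → Bool)
    (r : Fin N → Fin 3 → K) : lp (fun _ : Fin N → Fin 3 → Occ M => ℂ) 2 :=
  ⟨fun s => ∏ k, ∏ i, pulseAmp (ψ i) (z k i) (s k i) (r k i), by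
    refine (memℓp_gen_iff (by norm_num)).2 ?_
    simp only [norm_prod, ← Real.finsetProd_rpow _ _ (fun _ _ => norm_nonneg _),
      ← Real.finsetProd_rpow _ _ (fun _ _ => Finset.prod_nonneg fun _ _ => norm_nonneg _)]
    refine summable_pi_prod (fun k (s : Fin 3 → Occ M) => ∏ i,
      ‖pulseAmp (ψ i) (z k i) (s i) (r k i)‖ ^ (2 : ENNReal).toReal)
      (fun k s => Finset.prod_nonneg fun i _ => by positivity) fun k => ?_
    exact summable_pi_prod (fun i (s : Occ M) =>
      ‖pulseAmp (ψ i) (z k i) s (r k i)‖ ^ (2 : ENNReal).toReal) (fun i s => by positivity)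
      fun i => (memℓp_gen_iff (by norm_num)).1 (memℓp_pulseAmp (ψ i) (z k i) (r k i))⟩

/-! ### Eve's attack and Bob's received systems

For each block Bob's basis `Fin 3` consists of one photon in the pulse `(u,1)` of the upper arm, one
photon in the second pulse at the entrance of the first beam splitter, and one photon in the pulse
`(l,3)` of the lower arm.  The label `none` stands for all other photon contents of these three
pulses (no photon, or two and more), i.e. for no detection event. -/

/-- A coherent attack on `N` blocks: an arbitrary isometry from the light sent by Alice to Bob's
systems and an environment `E`.  It includes the channel, the detector inefficiencies and stray
photons in front of Bob's interferometer, the splitting of the first and third pulses, and, in `E`,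
the contents of the blocks without a detection event. -/
abbrev Attack (N : ℕ) (M E : Type*) [NormedAddCommGroup E] [InnerProductSpace ℂ E] :=
  lp (fun _ : Fin N → Fin 3 → Occ M => ℂ) 2 →ₗᵢ[ℂ] PiLp 2 (fun _ : Fin N → Option (Fin 3) => E)

/-- Basis of Alice's three qubits (`Z`-basis) and Bob's system for one block. -/
abbrev Blk := (Fin 3 → Bool) × Option (Fin 3)

/-- The density matrix of Alice's qubits and Bob's systems of all `N` blocks after the attack
(partial trace over the purifying systems and the environment). -/
def sharedState {M K E : Type*} [NormedAddCommGroup E] [InnerProductSpace ℂ E] (N : ℕ)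
    (ψ : Fin 3 → Bool → FockR M K) (V : Attack N M E) :
    Matrix (Fin N → Blk) (Fin N → Blk) ℂ := fun x y =>
  ∑' r : Fin N → Fin 3 → K,
    inner ℂ (V (blocksAmp N ψ (fun k => (y k).1) r) (fun k => (y k).2))
      (V (blocksAmp N ψ (fun k => (x k).1) r) (fun k => (x k).2))

/-! ### Measurements on one detected block

Time slot `j : Fin 2`: there the pulses `(u,j)` and `(l,j+1)` interfere. Alice's key bit is
`b_j ⊕ b_{j+1}`. -/

/-- `|v⟩⟨v|`. -/
def proj {n : Type*} (v : n → ℂ) : Matrix n n ℂ := Matrix.vecMulVec v (star v)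

/-- One-photon vector, pulled back through the first beam splitter, of the pulse in the upper
(`up = true`) or lower arm that arrives at the second beam splitter in time slot `j`. -/
def armVec (η₁ : ℝ) (j : Fin 2) (up : Bool) : Fin 3 → ℂ :=
  match j, up with
  | 0, true => Pi.single 0 1
  | 0, false => Pi.single 1 (√η₁ : ℂ)
  | 1, true => Pi.single 1 (√(1 - η₁) : ℂ)
  | 1, false => Pi.single 2 1

/-- One-photon vector of detector `D_d` in time slot `j`, pulled back through both beam
splitters. -/
def detVec (η₁ η₂ : ℝ) (j : Fin 2) (d : Bool) : Fin 3 → ℂ :=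
  if d then (√η₂ : ℂ) • armVec η₁ j true - (√(1 - η₂) : ℂ) • armVec η₁ j false
  else (√η₂ : ℂ) • armVec η₁ j false + (√(1 - η₂) : ℂ) • armVec η₁ j true

/-- `H^{⊗3} |b⟩` in the `Z`-basis. -/
def hadVec (b : Fin 3 → Bool) : (Fin 3 → Bool) → ℂ := fun z => ∏ i, had (z i) (b i)

/-- The bit error operator: Alice's key bit `b_j ⊕ b_{j+1}` differs from Bob's raw bit `d`. -/
def eBit (η₁ η₂ : ℝ) : Matrix ((Fin 3 → Bool) × Fin 3) ((Fin 3 → Bool) × Fin 3) ℂ :=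
  ∑ j : Fin 2, ∑ d : Bool,
    (∑ b : Fin 3 → Bool with (b j.castSucc ^^ b j.succ) ≠ d, proj (hadVec b)) ⊗ₖ
      proj (detVec η₁ η₂ j d)

/-- Alice's prediction of `z_j` from the parity `z_j ⊕ z_{j+1}` and from the arm in which Bob finds
the photon: for odd parity `z_j = 1` if the photon is in `(u,j)` and `z_j = 0` if it is in
`(l,j+1)`; for even parity `z_j = 0`. -/
def predict (parity up : Bool) : Bool := parity && up

/-- The phase error operator: Alice's prediction of `z_j` fails. -/
def ePh (η₁ : ℝ) : Matrix ((Fin 3 → Bool) × Fin 3) ((Fin 3 → Bool) × Fin 3) ℂ :=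
  ∑ j : Fin 2, ∑ up : Bool,
    (∑ z : Fin 3 → Bool with predict (z j.castSucc ^^ z j.succ) up ≠ z j.castSucc,
      proj (Pi.single z 1)) ⊗ₖ proj (armVec η₁ j up)

/-! ### The joint law of the outcomes of all blocks -/

/-- The outcome of a block: `none` if there is no detection event, `some (inl e)` for a code event
(`e` tells whether there is a phase error), `some (inr e)` for a sample event (`e` tells whether
there is a bit error). -/
abbrev Outcome := Option (Bool ⊕ Bool)

/-- An operator on Alice's qubits and the detected sector of Bob's system. -/
def onDetected (T : Matrix ((Fin 3 → Bool) × Fin 3) ((Fin 3 → Bool) × Fin 3) ℂ) :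
    Matrix Blk Blk ℂ := fun x y =>
  match x.2, y.2 with
  | some i, some j => T (x.1, i) (y.1, j)
  | _, _ => 0

/-- The projector onto the sector without a detection event. -/
def notDetected : Matrix Blk Blk ℂ := Matrix.diagonal fun x => if x.2 = none then 1 else 0

/-- POVM of one block; a detected block is a code event with probability `t`. -/
def blockPOVM (t η₁ η₂ : ℝ) : Outcome → Matrix Blk Blk ℂ
  | none => notDetected
  | some (Sum.inl true) => (t : ℂ) • onDetected (ePh η₁)
  | some (Sum.inl false) => (t : ℂ) • onDetected (1 - ePh η₁)
  | some (Sum.inr true) => ((1 - t : ℝ) : ℂ) • onDetected (eBit η₁ η₂)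
  | some (Sum.inr false) => ((1 - t : ℝ) : ℂ) • onDetected (1 - eBit η₁ η₂)

/-- The tensor product of the POVM elements of the blocks for the outcomes `o`. -/
def prodPOVM {N : ℕ} (t η₁ η₂ : ℝ) (o : Fin N → Outcome) :
    Matrix (Fin N → Blk) (Fin N → Blk) ℂ :=
  fun x y => ∏ k, blockPOVM t η₁ η₂ (o k) (x k) (y k)

/-- The probability of the outcomes `o` of all blocks: the Born rule for the product of the POVMs
of the blocks. -/
def prob {M K E : Type*} [NormedAddCommGroup E] [InnerProductSpace ℂ E] {N : ℕ} (t η₁ η₂ : ℝ)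
    (ψ : Fin 3 → Bool → FockR M K) (V : Attack N M E) (o : Fin N → Outcome) : ℝ :=
  (Matrix.trace (prodPOVM t η₁ η₂ o * sharedState N ψ V)).re

open Classical in
/-- The probability of an event. -/
def Pr {M K E : Type*} [NormedAddCommGroup E] [InnerProductSpace ℂ E] {N : ℕ} (t η₁ η₂ : ℝ)
    (ψ : Fin 3 → Bool → FockR M K) (V : Attack N M E) (A : Set (Fin N → Outcome)) : ℝ :=
  ∑ o with o ∈ A, prob t η₁ η₂ ψ V o

/-! ### Observed quantities -/

/-- Number of detection events. -/
def nDet {N : ℕ} (o : Fin N → Outcome) : ℕ := {k | o k ≠ none}.ncard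

/-- Number of code events. -/
def nCode {N : ℕ} (o : Fin N → Outcome) : ℕ := {k | ∃ e, o k = some (Sum.inl e)}.ncard

/-- Number of sample events. -/
def nSample {N : ℕ} (o : Fin N → Outcome) : ℕ := {k | ∃ e, o k = some (Sum.inr e)}.ncard

/-- Number of phase errors (in code events). -/
def nPh {N : ℕ} (o : Fin N → Outcome) : ℕ := {k | o k = some (Sum.inl true)}.ncard

/-- Number of bit errors (in sample events). -/
def nBit {N : ℕ} (o : Fin N → Outcome) : ℕ := {k | o k = some (Sum.inr true)}.ncard

/-- `Q = N_det / N_em`. -/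
def detRate {N : ℕ} (o : Fin N → Outcome) : ℝ := nDet o / N

/-- The phase error rate `N_ph / N_code`. -/
def phaseErrorRate {N : ℕ} (o : Fin N → Outcome) : ℝ := nPh o / nCode o

/-- The bit error rate of the sample events. -/
def bitErrorRate {N : ℕ} (o : Fin N → Outcome) : ℝ := nBit o / nSample o

/-- The function `λ(η₁, η₂)`. -/
def lam (η₁ η₂ : ℝ) : ℝ :=
  (1 - (1 - η₁) * η₂ +
      √((1 - (1 - η₁) * η₂) ^ 2 - 4 * η₁ * (1 - η₁) * (1 - η₂) ^ 2)) /
    (2 * (1 - η₁) * (1 - η₂) ^ 2)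

/-- The upper bound on the phase error rate, where `δ₁, δ₂` are the tolerances of the beam
splitters. -/
def phaseErrorBound {N : ℕ} (δ₁ δ₂ : ℝ) (q : ℕ → ℝ) (o : Fin N → Outcome) : ℝ :=
  lam (1 / 2 + δ₁) (1 / 2 + δ₂) *
      (bitErrorRate o + √(q 1 * q 3) / detRate o + 2 * δ₂) + q 2 / detRate o

end DPS

end

/-!
The proof is a direct exponential-moment (Chernoff) bound for the coherent attack; no reduction to
independent blocks and no martingale is needed.

*One block.* Alice's `Z`-basis outcome `z` is `1` only if the pulse is not in the vacuum, because the
purifications have equal vacuum components. Hence `n` ones in a block are at most as likely as `n`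
photons (`IsPurification.sum_zProb_le`). With no `1` there is no phase error. With exactly one `1`,
both error operators split into blocks of small dimension, on which the phase error operator is at
most `λ` times the bit error operator, up to the imbalance of the second beam splitter
(`oddForm_one_ge`); this is where `λ` comes from. The bit error operator flips two `Z`-basis bits at
a time, so besides this sector only its coherence with `z = 111` matters. As the operator lies
between `0` and `1`, polarization bounds that coherence by `(c P₁ + c⁻¹ P₃) / 2` for every weight
`c > 0` (`oddForm_cross`); a good choice of `c` gives `√(q₁ q₃)`. With two and more ones the phase
error probability is bounded by one, which gives `q₂`. Altogether (`ePh_sub_le`)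
`ePh ≤ λ (eBit + 2 δ₂) + W`, where `W` is diagonal in `z` and does not act on Bob's system.

*All blocks.* For a score `f` of the outcomes of detected blocks whose mean operator is at most
`W`, the operator `∑ₒ exp (θ f(o) - (θ B)²) Πₒ` of one block is at most `1 + θ W`
(`sum_expWeight_smul_le`). Tensor products of positive operators are monotone (`piTensor_mono`), and
Alice's outcomes `z` are independent and untouched by Eve (`expect_diagonal`), so that the
exponential moment of the total score is at most `exp (θ ⟨W⟩ N)`
(`sum_prob_mul_prod_expWeight_le`). The compensating term `(θ B)²` is paid only by detected blocks;
therefore the deviations are small compared to the number of detection events, however many blocks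
have been emitted (`Pr_score_le`).

This is applied to the score `phaseScore`, which compares phase errors to bit errors, and to
`codeScore`, which controls the fraction of code events. If the phase error rate exceeds the bound,
then one of the two scores is too large (`score_of_phaseErrorBound_lt`).

*Purifications.* The columns of `√ρ` purify `ρ`; as the vacuum columns for both bits have equal
norms, an isometry of the purifying system makes them equal (`exists_isPurification`).
-/

noncomputable section

namespace DPS

open scoped ComplexOrder MatrixOrder

/-! ### Sums over product index sets -/

theorem hasSum_pi_prod {ι α : Type*} [Fintype ι] {f : ι → α → ℝ} {S : ι → ℝ}
    (h0 : ∀ i a, 0 ≤ f i a) (hf : ∀ i, HasSum (f i) (S i)) :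
    HasSum (fun s : ι → α => ∏ i, f i (s i)) (∏ i, S i) := by
  classical
  have hs := (summable_pi_prod f h0 fun i => (hf i).summable).hasSum
  have ht : Filter.Tendsto (fun u : Finset α => Fintype.piFinset fun _ : ι => u)
      Filter.atTop Filter.atTop := by
    refine Filter.tendsto_atTop_finset_of_monotone
      (fun u v huv => Fintype.piFinset_subset _ _ fun _ => huv) fun s => ?_
    exact ⟨Finset.univ.image s, Fintype.mem_piFinset.2 fun i =>
      Finset.mem_image_of_mem s (Finset.mem_univ i)⟩
  have h1 := hs.comp ht
  have h2 : Filter.Tendsto (fun u : Finset α => ∏ i, ∑ a ∈ u, f i a) Filter.atTop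
      (nhds (∏ i, S i)) := tendsto_finsetProd _ fun i _ => hf i
  have h3 := tendsto_nhds_unique (h1.congr fun u => ?_) h2
  · rw [← h3]; exact hs
  · exact (Finset.prod_univ_sum _ _).symm

/-! ### Purifications with equal vacuum components -/

/-- The isometries of a complex Hilbert space act transitively on each sphere. -/
theorem exists_linearIsometryEquiv_apply_eq {H : Type*} [NormedAddCommGroup H]
    [InnerProductSpace ℂ H] (v w : H) (h : ‖v‖ = ‖w‖) : ∃ U : H →ₗᵢ[ℂ] H, U v = w := by
  -- Rotate the phase of `v` until the inner product with `w` is real; then reflect.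
  obtain ⟨c, hc, hcx⟩ := RCLike.exists_norm_eq_mul_self (inner ℂ w v : ℂ)
  set v' := c • v with hv'
  have hvw : inner ℂ w v' = (‖(inner ℂ w v : ℂ)‖ : ℂ) := by
    rw [hv', inner_smul_right]; exact hcx.symm
  have hwv : inner ℂ v' w = (‖(inner ℂ w v : ℂ)‖ : ℂ) := by
    rw [← inner_conj_symm, hvw, Complex.conj_ofReal]
  have hn : ‖v'‖ = ‖w‖ := by rw [hv', norm_smul, hc, one_mul, h]
  let R := (Submodule.span ℂ {v' - w})ᗮ.reflection
  have h1 : R (v' - w) = -(v' - w) := Submodule.reflection_orthogonalComplement_singleton_eq_neg _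
  have h2 : R (v' + w) = v' + w := by
    apply Submodule.reflection_mem_subspace_eq_self
    rw [Submodule.mem_orthogonal_singleton_iff_inner_right]
    rw [inner_sub_left, inner_add_right, inner_add_right, hvw, hwv, inner_self_eq_norm_sq_to_K,
      inner_self_eq_norm_sq_to_K, hn]
    ring
  have h3 : R v' = w := by
    have : (2 : ℂ) • R v' = (2 : ℂ) • w := by
      rw [← map_smul, show (2 : ℂ) • v' = (v' - w) + (v' + w) by module, map_add, h1, h2]; module
    exact smul_right_injective H two_ne_zero this
  let C : H →ₗᵢ[ℂ] H := ⟨c • LinearMap.id, fun x => by simp [norm_smul, hc]⟩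
  exact ⟨R.toLinearIsometry.comp C, h3⟩

/-- A positive operator is the square of a self-adjoint one. -/
theorem exists_inner_apply_eq_of_isPositive {H : Type*} [NormedAddCommGroup H]
    [InnerProductSpace ℂ H] [CompleteSpace H] {ρ : H →L[ℂ] H} (h : ρ.IsPositive) :
    ∃ T : H →L[ℂ] H, ∀ v w, inner ℂ (T v) (T w) = inner ℂ v (ρ w) := by
  have h0 : 0 ≤ ρ := (ContinuousLinearMap.nonneg_iff_isPositive ρ).2 h
  have hT : CFC.sqrt ρ * CFC.sqrt ρ = ρ := CFC.sqrt_mul_sqrt_self ρ h0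
  have hT0 : (CFC.sqrt ρ).IsPositive :=
    (ContinuousLinearMap.nonneg_iff_isPositive _).1 (CFC.sqrt_nonneg ρ)
  refine ⟨CFC.sqrt ρ, fun v w => ?_⟩
  have h1 := hT0.isSymmetric v (CFC.sqrt ρ w)
  have h2 := congrArg (fun S : H →L[ℂ] H => inner ℂ v (S w)) hT
  exact h1.trans h2

/-- A density operator is the Gram matrix of a family of vectors: the columns of its square
root. -/
theorem IsDensity.exists_gram {M : Type*} {ρ : Fock M →L[ℂ] Fock M} (h : IsDensity ρ) :
    ∃ x : Occ M → Fock M, ∀ s s', inner ℂ (x s) (x s') = elem ρ s s' := by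
  obtain ⟨T, hT⟩ := exists_inner_apply_eq_of_isPositive h.positive
  exact ⟨_, fun s s' => hT _ _⟩

theorem exists_isPurification {M : Type*} {ρ : Fin 3 → Bool → (Fock M →L[ℂ] Fock M)}
    {q : ℕ → ℝ} (h : IsSource ρ q) :
    ∃ ψ : Fin 3 → Bool → FockR M (Occ M), IsPurification ψ ρ := by
  choose x hx using fun i b => (h.density i b).exists_gram
  have hn : ∀ i, ‖x i true 0‖ = ‖x i false 0‖ := by
    intro i
    have h1 := h.vacuum i
    rw [← hx, ← hx, inner_self_eq_norm_sq_to_K, inner_self_eq_norm_sq_to_K] at h1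
    have h2 : ‖x i false 0‖ ^ 2 = ‖x i true 0‖ ^ 2 := by exact_mod_cast h1
    exact ((sq_eq_sq₀ (norm_nonneg _) (norm_nonneg _)).1 h2).symm
  choose U hU using fun i => exists_linearIsometryEquiv_apply_eq _ _ (hn i)
  let y : Fin 3 → Bool → Occ M → Fock M := fun i b s => if b then U i (x i b s) else x i b s
  have hy : ∀ i b s s', inner ℂ (y i b s) (y i b s') = elem (ρ i b) s s' := by
    intro i b s s'
    rw [← hx]
    cases b
    · rfl
    · exact (U i).inner_map_map _ _
  have hnorm : ∀ i b s, HasSum (fun r => ‖y i b s r‖ ^ (2 : ℝ)) (elem (ρ i b) s s).re := by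
    intro i b s
    have h1 := lp.hasSum_norm (p := 2) (by norm_num) (y i b s)
    have h2 : (elem (ρ i b) s s).re = ‖y i b s‖ ^ (2 : ENNReal).toReal := by
      rw [← hy, inner_self_eq_norm_sq_to_K]
      simp [← Complex.ofReal_pow]
    rw [h2]
    simpa using h1
  refine ⟨fun i b => ⟨fun p => conj (y i b p.1 p.2), ?_⟩, ?_, ?_⟩
  · refine (memℓp_gen_iff (by norm_num)).2 ?_
    refine (summable_prod_of_nonneg fun p => by positivity).2 ⟨fun s => ?_, ?_⟩
    · simpa using (hnorm i b s).summable
    · have h1 := (Complex.hasSum_re (h.density i b).trace_one).summable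
      refine h1.congr fun s => ?_
      rw [← (hnorm i b s).tsum_eq]
      simp
  · intro i b s s'
    have := lp.hasSum_inner (𝕜 := ℂ) (G := fun _ : Occ M => ℂ) (y i b s) (y i b s')
    rw [hy] at this
    suffices h1 : (fun r => conj (y i b s r) * conj (conj (y i b s' r))) =
        fun r => inner ℂ (y i b s r) (y i b s' r) from h1 ▸ this
    funext r
    simp [mul_comm]
  · intro i r
    have h1 : y i true 0 = y i false 0 := hU i
    change conj (y i false 0 r) = conj (y i true 0 r)
    rw [h1]

/-! ### Tensor products and operators of one block -/

/-- The tensor product `⨂ k, A k`, as a matrix indexed by functions. -/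
def piTensor {ι n : Type*} [Fintype ι] (A : ι → Matrix n n ℂ) : Matrix (ι → n) (ι → n) ℂ :=
  fun x y => ∏ k, A k (x k) (y k)

theorem _root_.Matrix.PosSemidef.exists_eq_conjTranspose_mul_self {n : Type*} [Fintype n]
    {A : Matrix n n ℂ} (h : A.PosSemidef) : ∃ B : Matrix n n ℂ, A = B.conjTranspose * B := by
  classical
  exact CStarAlgebra.nonneg_iff_eq_star_mul_self.mp h.nonneg

theorem piTensor_posSemidef {ι n : Type*} [Fintype ι] [Fintype n] {A : ι → Matrix n n ℂ}
    (h : ∀ k, (A k).PosSemidef) : (piTensor A).PosSemidef := by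
  classical
  choose B hB using fun k => (h k).exists_eq_conjTranspose_mul_self
  have : piTensor A = (piTensor B).conjTranspose * piTensor B := by
    ext x y
    simp only [piTensor, Matrix.mul_apply, Matrix.conjTranspose_apply, hB]
    rw [Finset.prod_univ_sum]
    simp only [Fintype.piFinset_univ, Finset.prod_mul_distrib, star_prod]
  rw [this]
  exact Matrix.posSemidef_conjTranspose_mul_self _

theorem piTensor_mono {ι n : Type*} [Fintype ι] [Fintype n] {A B : ι → Matrix n n ℂ}
    (hA : ∀ k, (A k).PosSemidef) (h : ∀ k, A k ≤ B k) : piTensor A ≤ piTensor B := by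
  classical
  -- Expand `⨂ (A + (B - A))`: one of the summands is `⨂ A`, and all are positive.
  have hexp : piTensor B = ∑ t ∈ (Finset.univ : Finset ι).powerset,
      piTensor fun k => if k ∈ t then A k else B k - A k := by
    ext x y
    rw [Matrix.sum_apply]
    have h1 : piTensor B x y = ∏ k, (A k (x k) (y k) + (B k - A k) (x k) (y k)) := by
      simp [piTensor]
    rw [h1, Finset.prod_add]
    refine Finset.sum_congr rfl fun t _ => ?_
    rw [piTensor, ← Finset.prod_sdiff (Finset.subset_univ t), mul_comm]
    congr 1
    · exact Finset.prod_congr rfl fun k hk => by rw [if_neg (Finset.mem_sdiff.1 hk).2]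
    · exact Finset.prod_congr rfl fun k hk => by rw [if_pos hk]
  have hpos : ∀ t : Finset ι, 0 ≤ piTensor fun k => if k ∈ t then A k else B k - A k := by
    intro t
    refine (piTensor_posSemidef fun k => ?_).nonneg
    split_ifs
    · exact hA k
    · exact Matrix.le_iff.1 (h k)
  rw [hexp]
  have := Finset.single_le_sum (fun t _ => hpos t)
    (Finset.mem_powerset_self (Finset.univ : Finset ι))
  simpa using this

theorem onDetected_posSemidef {T : Matrix ((Fin 3 → Bool) × Fin 3) ((Fin 3 → Bool) × Fin 3) ℂ}
    (h : T.PosSemidef) : (onDetected T).PosSemidef := by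
  obtain ⟨B, rfl⟩ := h.exists_eq_conjTranspose_mul_self
  let C : Matrix ((Fin 3 → Bool) × Fin 3) Blk ℂ := Matrix.of fun m x =>
    match x.2 with
    | some i => B m (x.1, i)
    | none => 0
  have : onDetected (B.conjTranspose * B) = C.conjTranspose * C := by
    ext ⟨z, _ | i⟩ ⟨z', _ | j⟩ <;> simp [onDetected, C, Matrix.mul_apply]
  rw [this]
  exact Matrix.posSemidef_conjTranspose_mul_self _

theorem onDetected_add (S T : Matrix ((Fin 3 → Bool) × Fin 3) ((Fin 3 → Bool) × Fin 3) ℂ) :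
    onDetected (S + T) = onDetected S + onDetected T := by
  ext ⟨z, _ | i⟩ ⟨z', _ | j⟩ <;> simp [onDetected]

theorem onDetected_sub (S T : Matrix ((Fin 3 → Bool) × Fin 3) ((Fin 3 → Bool) × Fin 3) ℂ) :
    onDetected (S - T) = onDetected S - onDetected T := by
  ext ⟨z, _ | i⟩ ⟨z', _ | j⟩ <;> simp [onDetected]

theorem onDetected_smul (c : ℂ) (T : Matrix ((Fin 3 → Bool) × Fin 3) ((Fin 3 → Bool) × Fin 3) ℂ) :
    onDetected (c • T) = c • onDetected T := by
  ext ⟨z, _ | i⟩ ⟨z', _ | j⟩ <;> simp [onDetected]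

theorem onDetected_mono {S T : Matrix ((Fin 3 → Bool) × Fin 3) ((Fin 3 → Bool) × Fin 3) ℂ}
    (h : S ≤ T) : onDetected S ≤ onDetected T := by
  rw [Matrix.le_iff, ← onDetected_sub]
  exact onDetected_posSemidef (Matrix.le_iff.1 h)

theorem notDetected_posSemidef : notDetected.PosSemidef :=
  Matrix.PosSemidef.diagonal fun x => by
    change (0 : ℂ) ≤ if x.2 = none then 1 else 0
    split_ifs <;> simp

/-! ### Alice's marginal -/

section State
variable {M K E : Type*} [NormedAddCommGroup E] [InnerProductSpace ℂ E]

/-- The probability of the `Z`-basis outcome `z` of Alice's qubit of one pulse. -/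
def pulseProb (ψ : Bool → FockR M K) (z : Bool) : ℝ := ∑' r, ∑' s, ‖pulseAmp ψ z s r‖ ^ 2

theorem summable_sq_pulseAmp (ψ : Bool → FockR M K) (z : Bool) :
    Summable fun p : Occ M × K => ‖pulseAmp ψ z p.1 p.2‖ ^ 2 := by
  have h := lp.memℓp ((had z true / (√2 : ℝ)) • ψ true + (had z false / (√2 : ℝ)) • ψ false)
  have h1 := (memℓp_gen_iff (by norm_num)).1 h
  refine h1.congr fun p => ?_
  simp only [pulseAmp, Fintype.sum_bool, lp.coeFn_add, lp.coeFn_smul, Pi.add_apply, Pi.smul_apply,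
    smul_eq_mul, ENNReal.toReal_ofNat, Real.rpow_ofNat]
  congr 2
  ring

theorem pulseProb_nonneg (ψ : Bool → FockR M K) (z : Bool) : 0 ≤ pulseProb ψ z :=
  tsum_nonneg fun _ => tsum_nonneg fun _ => by positivity

theorem sq_norm_blocksAmp (N : ℕ) (ψ : Fin 3 → Bool → FockR M K) (z : Fin N → Fin 3 → Bool)
    (r : Fin N → Fin 3 → K) :
    ‖blocksAmp N ψ z r‖ ^ 2 = ∏ k, ∏ i, ∑' s, ‖pulseAmp (ψ i) (z k i) s (r k i)‖ ^ 2 := by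
  have h1 := lp.hasSum_norm (p := 2) (by norm_num) (blocksAmp N ψ z r)
  have h2 : HasSum (fun s : Fin N → Fin 3 → Occ M =>
      ∏ k, ∏ i, ‖pulseAmp (ψ i) (z k i) (s k i) (r k i)‖ ^ 2)
      (∏ k, ∏ i, ∑' s, ‖pulseAmp (ψ i) (z k i) s (r k i)‖ ^ 2) := by
    refine hasSum_pi_prod (f := fun k (s : Fin 3 → Occ M) =>
      ∏ i, ‖pulseAmp (ψ i) (z k i) (s i) (r k i)‖ ^ 2)
      (fun k s => Finset.prod_nonneg fun i _ => by positivity) fun k => ?_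
    refine hasSum_pi_prod (f := fun i (s : Occ M) =>
      ‖pulseAmp (ψ i) (z k i) s (r k i)‖ ^ 2) (fun i s => by positivity) fun i => ?_
    exact ((summable_sq_pulseAmp (ψ i) (z k i)).comp_injective
      (i := fun s : Occ M => (s, r k i)) fun s s' h => (Prod.mk.inj h).1).hasSum
  refine (HasSum.unique ?_ h2)
  convert h1 using 2 with s
  · simp [blocksAmp, Finset.prod_pow]
  · simp

theorem hasSum_sq_norm_blocksAmp (N : ℕ) (ψ : Fin 3 → Bool → FockR M K)
    (z : Fin N → Fin 3 → Bool) :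
    HasSum (fun r => ‖blocksAmp N ψ z r‖ ^ 2) (∏ k, ∏ i, pulseProb (ψ i) (z k i)) := by
  simp only [sq_norm_blocksAmp]
  refine hasSum_pi_prod (f := fun k (r : Fin 3 → K) =>
    ∏ i, ∑' s, ‖pulseAmp (ψ i) (z k i) s (r i)‖ ^ 2)
    (fun k s => Finset.prod_nonneg fun i _ => tsum_nonneg fun _ => by positivity) fun k => ?_
  refine hasSum_pi_prod (f := fun i (r : K) =>
    ∑' s, ‖pulseAmp (ψ i) (z k i) s r‖ ^ 2)
    (fun i s => tsum_nonneg fun _ => by positivity) fun i => ?_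
  exact (summable_sq_pulseAmp (ψ i) (z k i)).prod_symm.prod.hasSum

/-! ### The Born rule as a positive functional -/

/-- The environment part of the joint vector after the attack, for the basis vectors `x` of Alice's
qubits and Bob's systems and `r` of the purifying systems. -/
def envVec {N : ℕ} (ψ : Fin 3 → Bool → FockR M K) (V : Attack N M E)
    (r : Fin N → Fin 3 → K) (x : Fin N → Blk) : E :=
  V (blocksAmp N ψ (fun k => (x k).1) r) (fun k => (x k).2)

theorem summable_inner_envVec {N : ℕ} (ψ : Fin 3 → Bool → FockR M K) (V : Attack N M E)
    (x y : Fin N → Blk) :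
    Summable fun r => (inner ℂ (envVec ψ V r x) (envVec ψ V r y) : ℂ) := by
  have hle : ∀ r x, ‖envVec ψ V r x‖ ≤ ‖blocksAmp N ψ (fun k => (x k).1) r‖ := fun r x => by
    rw [← V.norm_map]
    exact PiLp.norm_apply_le _ _
  refine Summable.of_norm_bounded ((hasSum_sq_norm_blocksAmp N ψ fun k => (x k).1).add
    (hasSum_sq_norm_blocksAmp N ψ fun k => (y k).1)).summable fun r => ?_
  have h1 := norm_inner_le_norm (𝕜 := ℂ) (envVec ψ V r x) (envVec ψ V r y)
  have h2 := mul_le_mul (hle r x) (hle r y) (norm_nonneg _) (norm_nonneg _)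
  nlinarith [sq_nonneg (‖blocksAmp N ψ (fun k => (x k).1) r‖ -
    ‖blocksAmp N ψ (fun k => (y k).1) r‖), norm_nonneg (blocksAmp N ψ (fun k => (x k).1) r),
    norm_nonneg (blocksAmp N ψ (fun k => (y k).1) r)]

/-- The expectation value `Re Tr (A σ)` in the state `σ` shared by Alice and Bob. -/
def expect {N : ℕ} (ψ : Fin 3 → Bool → FockR M K) (V : Attack N M E)
    (A : Matrix (Fin N → Blk) (Fin N → Blk) ℂ) : ℝ :=
  (Matrix.trace (A * sharedState N ψ V)).re

theorem hasSum_expect {N : ℕ} (ψ : Fin 3 → Bool → FockR M K) (V : Attack N M E)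
    (A : Matrix (Fin N → Blk) (Fin N → Blk) ℂ) :
    HasSum (fun r => (∑ x, ∑ y, A x y * inner ℂ (envVec ψ V r x) (envVec ψ V r y)).re)
      (expect ψ V A) := by
  refine Complex.hasSum_re ?_
  simp only [Matrix.trace, Matrix.diag, Matrix.mul_apply]
  exact hasSum_sum fun x _ => hasSum_sum fun y _ =>
    (summable_inner_envVec ψ V x y).hasSum.mul_left _

theorem expect_nonneg {N : ℕ} (ψ : Fin 3 → Bool → FockR M K) (V : Attack N M E)
    {A : Matrix (Fin N → Blk) (Fin N → Blk) ℂ} (hA : A.PosSemidef) : 0 ≤ expect ψ V A := by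
  obtain ⟨B, rfl⟩ := hA.exists_eq_conjTranspose_mul_self
  refine (hasSum_expect ψ V _).nonneg fun r => ?_
  have : ∑ x, ∑ y, (B.conjTranspose * B) x y * inner ℂ (envVec ψ V r x) (envVec ψ V r y) =
      ∑ k, inner ℂ (∑ x, B k x • envVec ψ V r x) (∑ x, B k x • envVec ψ V r x) := by
    simp only [sum_inner, inner_sum, inner_smul_left, inner_smul_right, Matrix.mul_apply,
      Matrix.conjTranspose_apply, Finset.sum_mul, Finset.mul_sum]
    rw [Finset.sum_comm]
    conv_rhs => rw [Finset.sum_comm]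
    refine Finset.sum_congr rfl fun y _ => ?_
    conv_rhs => rw [Finset.sum_comm]
    refine Finset.sum_congr rfl fun x _ => Finset.sum_congr rfl fun k _ => ?_
    simp only [RCLike.star_def]
    ring
  rw [this, Complex.re_sum]
  exact Finset.sum_nonneg fun k _ => inner_self_nonneg (𝕜 := ℂ)

theorem expect_mono {N : ℕ} (ψ : Fin 3 → Bool → FockR M K) (V : Attack N M E)
    {A B : Matrix (Fin N → Blk) (Fin N → Blk) ℂ} (h : A ≤ B) : expect ψ V A ≤ expect ψ V B := by
  have := expect_nonneg ψ V (Matrix.le_iff.1 h)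
  simpa [expect, sub_mul, Matrix.trace_sub] using this

/-- The attack does not change the `Z`-basis statistics of Alice's qubits, which are independent. -/
theorem expect_diagonal {N : ℕ} (ψ : Fin 3 → Bool → FockR M K) (V : Attack N M E)
    (D : (Fin N → Fin 3 → Bool) → ℝ) :
    expect ψ V (Matrix.diagonal fun x => (D fun k => (x k).1 : ℂ)) =
      ∑ z, D z * ∏ k, ∏ i, pulseProb (ψ i) (z k i) := by
  refine (hasSum_expect ψ V _).unique ?_
  have h0 := hasSum_sum (s := Finset.univ) fun z _ =>
    (hasSum_sq_norm_blocksAmp N ψ z).mul_left (D z)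
  refine (congrArg (fun f => HasSum f _) (funext fun r => ?_)).mpr h0
  have h1 : ∀ x : Fin N → Blk, ∑ y, (Matrix.diagonal fun x : Fin N → Blk =>
      (D fun k => (x k).1 : ℂ)) x y * inner ℂ (envVec ψ V r x) (envVec ψ V r y) =
      ((D fun k => (x k).1) * ‖envVec ψ V r x‖ ^ 2 : ℝ) := by
    intro x
    rw [Finset.sum_eq_single x]
    · simp [inner_self_eq_norm_sq_to_K]
    · intro y _ hy
      simp [Matrix.diagonal_apply_ne' _ hy]
    · simp
  simp only [h1]
  rw [← Complex.ofReal_sum, Complex.ofReal_re,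
    ← (Equiv.arrowProdEquivProdArrow (Fin N) (fun _ => Fin 3 → Bool)
      (fun _ => Option (Fin 3))).symm.sum_comp, Fintype.sum_prod_type]
  refine Finset.sum_congr rfl fun z _ => ?_
  rw [← V.norm_map, PiLp.norm_sq_eq_of_L2, Finset.mul_sum]
  rfl

end State

/-! ### Photon numbers and Alice's `Z`-basis outcomes -/

section Source
variable {M K : Type*}

/-- The probability that Alice's qubit of one pulse has the `Z`-basis outcome `z` and the pulse has
the occupation numbers `s`. -/
def jointProb (ψ : Bool → FockR M K) (z : Bool) (s : Occ M) : ℝ := ∑' r, ‖pulseAmp ψ z s r‖ ^ 2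

theorem jointProb_nonneg (ψ : Bool → FockR M K) (z : Bool) (s : Occ M) : 0 ≤ jointProb ψ z s :=
  tsum_nonneg fun _ => by positivity

theorem hasSum_jointProb (ψ : Bool → FockR M K) (z : Bool) :
    HasSum (jointProb ψ z) (pulseProb ψ z) := by
  have h := summable_sq_pulseAmp ψ z
  have h1 : pulseProb ψ z = ∑' s, jointProb ψ z s :=
    (Summable.tsum_comm (f := fun s r => ‖pulseAmp ψ z s r‖ ^ 2) h)
  rw [h1]
  exact h.prod.hasSum

theorem sq_norm_pulseAmp_add (ψ : Bool → FockR M K) (s : Occ M) (r : K) :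
    ‖pulseAmp ψ true s r‖ ^ 2 + ‖pulseAmp ψ false s r‖ ^ 2 =
      (‖ψ true (s, r)‖ ^ 2 + ‖ψ false (s, r)‖ ^ 2) / 2 := by
  have h2 : ((√2 : ℝ) : ℂ) * (√2 : ℝ) = 2 := by
    rw [← Complex.ofReal_mul, Real.mul_self_sqrt (by norm_num)]; simp
  have ht : pulseAmp ψ true s r = (ψ false (s, r) - ψ true (s, r)) / 2 := by
    simp only [pulseAmp, had, Fintype.sum_bool]
    rw [← h2]
    simp
    ring
  have hf : pulseAmp ψ false s r = (ψ false (s, r) + ψ true (s, r)) / 2 := by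
    simp only [pulseAmp, had, Fintype.sum_bool]
    rw [← h2]
    simp
    ring
  rw [ht, hf, norm_div, norm_div]
  have := parallelogram_law_with_norm ℝ (ψ false (s, r)) (ψ true (s, r))
  simp only [Complex.norm_ofNat]
  nlinarith

variable {ρ : Fin 3 → Bool → (Fock M →L[ℂ] Fock M)} {ψ : Fin 3 → Bool → FockR M K} {q : ℕ → ℝ}

theorem IsPurification.hasSum_sq_norm (h : IsPurification ψ ρ) (i : Fin 3) (b : Bool) (s : Occ M) :
    HasSum (fun r => ‖ψ i b (s, r)‖ ^ 2) (elem (ρ i b) s s).re := by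
  have h1 := Complex.hasSum_re (h.purifies i b s s)
  simpa only [Complex.mul_conj, Complex.normSq_eq_norm_sq, Complex.ofReal_re] using h1

theorem IsPurification.elem_re_nonneg (h : IsPurification ψ ρ) (i : Fin 3) (b : Bool)
    (s : Occ M) : 0 ≤ (elem (ρ i b) s s).re :=
  (h.hasSum_sq_norm i b s).nonneg fun _ => by positivity

theorem IsPurification.sum_jointProb (h : IsPurification ψ ρ) (i : Fin 3) (s : Occ M) :
    ∑ z, jointProb (ψ i) z s = ∑ b, (elem (ρ i b) s s).re / 2 := by
  have hs : ∀ z, HasSum (fun r => ‖pulseAmp (ψ i) z s r‖ ^ 2) (jointProb (ψ i) z s) := fun z =>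
    ((summable_sq_pulseAmp (ψ i) z).comp_injective (i := fun r : K => (s, r))
      fun r r' h => (Prod.mk.inj h).2).hasSum
  have h1 := (hs true).add (hs false)
  have h2 := ((h.hasSum_sq_norm i true s).add (h.hasSum_sq_norm i false s)).div_const 2
  simp only [sq_norm_pulseAmp_add] at h1
  rw [Fintype.sum_bool, Fintype.sum_bool, h1.unique h2]
  ring

/-- The outcome `z = 1` excludes the vacuum, because the purifications have equal vacuum
components. -/
theorem IsPurification.jointProb_true_zero (h : IsPurification ψ ρ) (i : Fin 3) :
    jointProb (ψ i) true 0 = 0 := by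
  have : ∀ r, pulseAmp (ψ i) true 0 r = 0 := fun r => by
    simp [pulseAmp, had, h.vacuum i r]
    ring
  simp [jointProb, this]

theorem IsPurification.sum_pulseProb (h : IsPurification ψ ρ) (hρ : IsSource ρ q) (i : Fin 3) :
    ∑ z, pulseProb (ψ i) z = 1 := by
  have h1 := hasSum_sum (s := Finset.univ) fun z _ => hasSum_jointProb (ψ i) z
  simp only [h.sum_jointProb] at h1
  have h2 := hasSum_sum (s := Finset.univ) fun b _ =>
    (Complex.hasSum_re (hρ.density i b).trace_one).div_const 2
  rw [h1.unique h2]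
  simp

/-- The number of ones in the `Z`-basis outcome of a block. -/
def numOnes (z : Fin 3 → Bool) : ℕ := (Finset.univ.filter fun i => z i = true).card

/-- The probability of the `Z`-basis outcome `z` of Alice's qubits of one block. -/
def zProb (ψ : Fin 3 → Bool → FockR M K) (z : Fin 3 → Bool) : ℝ := ∏ i, pulseProb (ψ i) (z i)

theorem zProb_nonneg (z : Fin 3 → Bool) : 0 ≤ zProb ψ z :=
  Finset.prod_nonneg fun _ _ => pulseProb_nonneg _ _

theorem IsPurification.sum_zProb (h : IsPurification ψ ρ) (hρ : IsSource ρ q) :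
    ∑ z, zProb ψ z = 1 := by
  have := Finset.prod_univ_sum (fun _ : Fin 3 => (Finset.univ : Finset Bool))
    fun i z => pulseProb (ψ i) z
  rw [Fintype.piFinset_univ] at this
  simp only [zProb, ← this, h.sum_pulseProb hρ, Finset.prod_const_one]

/-- Each `1` among the `Z`-basis outcomes costs a photon: `n` ones are at most as likely as `n`
photons. -/
theorem IsPurification.sum_zProb_le (h : IsPurification ψ ρ) (hρ : IsSource ρ q) {n : ℕ}
    (h1 : 1 ≤ n) (h3 : n ≤ 3) : ∑ z with n ≤ numOnes z, zProb ψ z ≤ q n := by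
  have hL : HasSum (fun s : Fin 3 → Occ M => ∑ z with n ≤ numOnes z,
      ∏ i, jointProb (ψ i) (z i) (s i)) (∑ z with n ≤ numOnes z, zProb ψ z) :=
    hasSum_sum fun z _ => hasSum_pi_prod (f := fun i s => jointProb (ψ i) (z i) s)
      (fun i s => jointProb_nonneg _ _ _) fun i => hasSum_jointProb _ _
  have hR : HasSum (fun s : Fin 3 → Occ M => ∑ b : Fin 3 → Bool,
      (if n ≤ ∑ i, (s i).degree then ∏ i, (elem (ρ i (b i)) (s i) (s i)).re else 0) / 8)
      (∑ b, blockTail ρ b n / 8) := by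
    refine hasSum_sum fun b _ => HasSum.div_const (Summable.hasSum ?_) 8
    refine Summable.of_nonneg_of_le (fun s => ?_) (fun s => ?_)
      (summable_pi_prod (fun i s => (elem (ρ i (b i)) s s).re) (fun i s => h.elem_re_nonneg i _ s)
        fun i => (Complex.hasSum_re (hρ.density i (b i)).trace_one).summable)
    · split_ifs
      · exact Finset.prod_nonneg fun i _ => h.elem_re_nonneg i _ _
      · exact le_rfl
    · split_ifs
      · exact le_rfl
      · exact Finset.prod_nonneg fun i _ => h.elem_re_nonneg i _ _
  refine (hasSum_le (fun s => ?_) hL hR).trans ?_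
  · by_cases hs : n ≤ ∑ i, (s i).degree
    · simp only [if_pos hs]
      calc ∑ z with n ≤ numOnes z, ∏ i, jointProb (ψ i) (z i) (s i)
          ≤ ∑ z : Fin 3 → Bool, ∏ i, jointProb (ψ i) (z i) (s i) :=
            Finset.sum_le_sum_of_subset_of_nonneg (Finset.filter_subset _ _)
              fun z _ _ => Finset.prod_nonneg fun i _ => jointProb_nonneg _ _ _
        _ = ∏ i, ∑ z, jointProb (ψ i) z (s i) := by
            rw [Finset.prod_univ_sum, Fintype.piFinset_univ]
        _ = ∏ i, ∑ b, (elem (ρ i b) (s i) (s i)).re / 2 := by simp only [h.sum_jointProb]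
        _ = _ := by
            rw [Finset.prod_univ_sum, Fintype.piFinset_univ]
            refine Finset.sum_congr rfl fun b _ => ?_
            rw [Finset.prod_div_distrib]
            norm_num
    · simp only [if_neg hs, zero_div, Finset.sum_const_zero]
      refine (Finset.sum_eq_zero fun z hz => ?_).le
      by_contra hne
      refine hs ((Finset.mem_filter.1 hz).2.trans ?_)
      rw [numOnes, Finset.card_filter]
      refine Finset.sum_le_sum fun i _ => ?_
      split_ifs with hzi
      · by_contra hd
        have h0 : s i = 0 := by
          rw [← Finsupp.degree_eq_zero_iff]; omega
        refine hne (Finset.prod_eq_zero (Finset.mem_univ i) ?_)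
        rw [hzi, h0, h.jointProb_true_zero]
      · exact Nat.zero_le _
  · calc ∑ b, blockTail ρ b n / 8 ≤ ∑ b : Fin 3 → Bool, q n / 8 :=
          Finset.sum_le_sum fun b _ => div_le_div_of_nonneg_right (hρ.tail b n h1 h3) (by norm_num)
      _ = q n := by simp; ring

end Source

/-! ### The function `λ` -/

/-- `λ / 2` is not smaller than the larger root of `(1 - h) y² - (1 + h) y + h`, with equality for a
balanced second beam splitter `h₂ = 1/2`. In general `x = (1 - h₂) λ` is the larger root of
`(1 - h) x² - (1 + h (1 / (1 - h₂) - 1)) x + h`, which grows with `h₂`. -/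
theorem lam_half_spec {h h₂ : ℝ} (h1 : 1 / 2 ≤ h) (h1' : h < 1) (h2 : 1 / 2 ≤ h₂) (h2' : h₂ < 1) :
    1 ≤ lam h h₂ / 2 ∧
      0 ≤ (1 - h) * (lam h h₂ / 2) ^ 2 - (1 + h) * (lam h h₂ / 2) + h := by
  set w := 1 - h₂ with hw
  have hw0 : 0 < w := by linarith
  have hw1 : w ≤ 1 / 2 := by linarith
  have hh : 0 < 1 - h := by linarith
  set B := 1 - (1 - h) * h₂ with hB
  have hBw : B = w + h * (1 - w) := by rw [hB, hw]; ring
  have hD : 0 ≤ B ^ 2 - 4 * h * (1 - h) * w ^ 2 := by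
    have h3 : w * (1 + h) ≤ B := by rw [hBw]; nlinarith
    have h4 : (w * (1 + h)) ^ 2 ≤ B ^ 2 := pow_le_pow_left₀ (by positivity) h3 2
    nlinarith [sq_nonneg w, mul_nonneg (sq_nonneg w) (sq_nonneg (1 - h)),
      mul_nonneg (sq_nonneg w) (sq_nonneg h)]
  set R := √(B ^ 2 - 4 * h * (1 - h) * w ^ 2) with hR
  have hR0 : 0 ≤ R := Real.sqrt_nonneg _
  have hR2 : R ^ 2 = B ^ 2 - 4 * h * (1 - h) * w ^ 2 := Real.sq_sqrt hD
  have hl : lam h h₂ = (B + R) / (2 * (1 - h) * w ^ 2) := rfl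
  set y := lam h h₂ / 2 with hy
  set x := 2 * w * y with hx
  have hxe : x * (2 * (1 - h) * w) = B + R := by
    rw [hx, hy, hl]
    field_simp
  -- `x ≤ y`, and `x` lies to the right of the vertex of the balanced quadratic.
  have hx1 : w * (1 + h) ≤ x * (2 * (1 - h) * w) := by rw [hxe, hBw]; nlinarith
  have hx2 : 1 + h ≤ 2 * (1 - h) * x := by
    have : w * (1 + h) ≤ w * (2 * (1 - h) * x) := by linarith
    exact le_of_mul_le_mul_left this hw0
  have hx0 : 1 ≤ x := by nlinarith
  have hxy : x ≤ y := by
    have hy0 : 0 < y := by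
      by_contra hcon
      push Not at hcon
      have : x ≤ 0 := by rw [hx]; exact mul_nonpos_of_nonneg_of_nonpos (by positivity) hcon
      linarith
    rw [hx]; nlinarith
  have hxq : 0 ≤ (1 - h) * x ^ 2 - (1 + h) * x + h := by
    have h5 : (x * (2 * (1 - h) * w) - B) ^ 2 = B ^ 2 - 4 * h * (1 - h) * w ^ 2 := by
      rw [hxe, ← hR2]; ring
    have h6 : 4 * (1 - h) * w * (w * (1 - h) * x ^ 2 - B * x + h * w) = 0 := by linarith
    have h7 : w * (1 - h) * x ^ 2 - B * x + h * w = 0 := by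
      rcases mul_eq_zero.1 h6 with h | h
      · exact absurd h (by positivity)
      · exact h
    have h8 : w * ((1 - h) * x ^ 2 - (1 + h) * x + h) = (B - w * (1 + h)) * x := by linarith
    have h9 : 0 ≤ w * ((1 - h) * x ^ 2 - (1 + h) * x + h) := by
      rw [h8]
      exact mul_nonneg (by rw [hBw]; nlinarith) (by linarith)
    exact nonneg_of_mul_nonneg_right h9 hw0
  refine ⟨hx0.trans hxy, hxq.trans ?_⟩
  nlinarith [mul_nonneg (sub_nonneg.2 hxy) (by nlinarith : (0:ℝ) ≤ (1 - h) * (x + y) - (1 + h))]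

/-! ### One block: quadratic forms -/

/-- Amplitude of a real one-photon vector on `armVec η₁ j up`. -/
def armCoord (η₁ : ℝ) (j : Fin 2) (up : Bool) (w : Fin 3 → ℝ) : ℝ :=
  match j, up with
  | 0, true => w 0
  | 0, false => √η₁ * w 1
  | 1, true => √(1 - η₁) * w 1
  | 1, false => w 2

/-- Amplitude of a real one-photon vector on `detVec η₁ η₂ j d`. -/
def detCoord (η₁ η₂ : ℝ) (j : Fin 2) (d : Bool) (w : Fin 3 → ℝ) : ℝ :=
  if d then √η₂ * armCoord η₁ j true w - √(1 - η₂) * armCoord η₁ j false w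
  else √η₂ * armCoord η₁ j false w + √(1 - η₂) * armCoord η₁ j true w

/-- The sign `(-1)^d`. -/
def sgn (d : Bool) : ℝ := if d then -1 else 1

/-- `X_j X_{j+1}` on the `Z`-basis. -/
def flipPair (j : Fin 2) (z : Fin 3 → Bool) : Fin 3 → Bool :=
  fun i => if i = j.castSucc ∨ i = j.succ then !z i else z i

theorem flipPair_involutive (j : Fin 2) : Function.Involutive (flipPair j) := fun z => by
  funext i
  by_cases h : i = j.castSucc ∨ i = j.succ <;> simp [flipPair, h]

/-- `⟨x| eBit |x⟩` for real `x`. -/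
def bitForm (η₁ η₂ : ℝ) (x : (Fin 3 → Bool) → Fin 3 → ℝ) : ℝ :=
  ∑ j, ∑ d, ∑ z, (detCoord η₁ η₂ j d (x z) - sgn d * detCoord η₁ η₂ j d (x (flipPair j z))) ^ 2 / 4

/-- `⟨x| ePh |x⟩` for `x = |z⟩ ⊗ w` with `w` real; `ePh` is diagonal in `z`. -/
def phForm (η₁ : ℝ) (z : Fin 3 → Bool) (w : Fin 3 → ℝ) : ℝ :=
  ∑ j : Fin 2, ∑ up, if predict (z j.castSucc ^^ z j.succ) up ≠ z j.castSucc then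
    armCoord η₁ j up w ^ 2 else 0

theorem sum_armCoord_sq {η₁ : ℝ} (h0 : 0 ≤ η₁) (h1 : η₁ ≤ 1) (w : Fin 3 → ℝ) :
    ∑ j, ∑ up, armCoord η₁ j up w ^ 2 = ∑ i, w i ^ 2 := by
  simp only [Fin.sum_univ_two, Fin.sum_univ_three, Fintype.sum_bool, armCoord, mul_pow,
    Real.sq_sqrt h0, Real.sq_sqrt (sub_nonneg.2 h1)]
  ring

theorem sum_detCoord_sq {η₁ η₂ : ℝ} (h0 : 0 ≤ η₁) (h1 : η₁ ≤ 1) (h0' : 0 ≤ η₂) (h1' : η₂ ≤ 1)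
    (w : Fin 3 → ℝ) : ∑ j, ∑ d, detCoord η₁ η₂ j d w ^ 2 = ∑ i, w i ^ 2 := by
  rw [← sum_armCoord_sq h0 h1]
  refine Finset.sum_congr rfl fun j _ => ?_
  simp only [Fintype.sum_bool, detCoord, if_true, Bool.false_eq_true, if_false]
  linear_combination (armCoord η₁ j true w ^ 2 + armCoord η₁ j false w ^ 2) *
    (Real.sq_sqrt h0' + Real.sq_sqrt (sub_nonneg.2 h1'))

theorem phForm_le {η₁ : ℝ} (h0 : 0 ≤ η₁) (h1 : η₁ ≤ 1) (z : Fin 3 → Bool) (w : Fin 3 → ℝ) :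
    phForm η₁ z w ≤ ∑ i, w i ^ 2 := by
  rw [← sum_armCoord_sq h0 h1]
  refine Finset.sum_le_sum fun _ _ => Finset.sum_le_sum fun _ _ => ?_
  split_ifs
  · exact le_rfl
  · positivity

theorem bitForm_le {η₁ η₂ : ℝ} (h0 : 0 ≤ η₁) (h1 : η₁ ≤ 1) (h0' : 0 ≤ η₂) (h1' : η₂ ≤ 1)
    (x : (Fin 3 → Bool) → Fin 3 → ℝ) : bitForm η₁ η₂ x ≤ ∑ z, ∑ i, x z i ^ 2 := by
  have hs : ∑ z, ∑ i, x z i ^ 2 = ∑ j, ∑ d, ∑ z, detCoord η₁ η₂ j d (x z) ^ 2 := by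
    simp only [← sum_detCoord_sq h0 h1 h0' h1']
    rw [Finset.sum_comm]
    exact Finset.sum_congr rfl fun j _ => Finset.sum_comm
  rw [hs]
  refine Finset.sum_le_sum fun j _ => Finset.sum_le_sum fun d _ => ?_
  have hf : ∑ z, detCoord η₁ η₂ j d (x (flipPair j z)) ^ 2 = ∑ z, detCoord η₁ η₂ j d (x z) ^ 2 :=
    Equiv.sum_comp (flipPair_involutive j).toPerm fun z => detCoord η₁ η₂ j d (x z) ^ 2
  have h2 : ∑ z, detCoord η₁ η₂ j d (x z) ^ 2 = ∑ z, (detCoord η₁ η₂ j d (x z) ^ 2 +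
      detCoord η₁ η₂ j d (x (flipPair j z)) ^ 2) / 2 := by
    rw [← Finset.sum_div, Finset.sum_add_distrib, hf]
    ring
  rw [h2]
  refine Finset.sum_le_sum fun z _ => ?_
  have : sgn d ^ 2 = 1 := by cases d <;> simp [sgn]
  nlinarith [sq_nonneg (detCoord η₁ η₂ j d (x z) + sgn d * detCoord η₁ η₂ j d (x (flipPair j z)))]

theorem sum_bits {α : Type*} [AddCommMonoid α] (f : (Fin 3 → Bool) → α) :
    ∑ z, f z = (f ![false, false, false] + f ![true, true, false] + f ![true, false, true] +
      f ![false, true, true]) + (f ![true, false, false] + f ![false, true, false] +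
      f ![false, false, true] + f ![true, true, true]) := by
  rw [show (Finset.univ : Finset (Fin 3 → Bool)) = {![false, false, false], ![true, true, false],
    ![true, false, true], ![false, true, true], ![true, false, false], ![false, true, false],
    ![false, false, true], ![true, true, true]} by decide]
  repeat rw [Finset.sum_insert (by decide)]
  rw [Finset.sum_singleton]
  simp only [add_assoc]

/-- The part of `bitForm` with an odd number of ones; `a`, `b`, `g`, `h` are the components for
Alice's outcomes `100`, `010`, `001` and `111`. -/
def oddForm (η₁ η₂ : ℝ) (a b g h : Fin 3 → ℝ) : ℝ :=
  ∑ d, ((detCoord η₁ η₂ 0 d a - sgn d * detCoord η₁ η₂ 0 d b) ^ 2 +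
    (detCoord η₁ η₂ 0 d g - sgn d * detCoord η₁ η₂ 0 d h) ^ 2 +
    (detCoord η₁ η₂ 1 d b - sgn d * detCoord η₁ η₂ 1 d g) ^ 2 +
    (detCoord η₁ η₂ 1 d a - sgn d * detCoord η₁ η₂ 1 d h) ^ 2) / 2

/-- The bit error operator preserves the parity of the number of ones, so its even part can be
dropped. -/
theorem oddForm_le_bitForm (η₁ η₂ : ℝ) (x : (Fin 3 → Bool) → Fin 3 → ℝ) :
    oddForm η₁ η₂ (x ![true, false, false]) (x ![false, true, false]) (x ![false, false, true])
      (x ![true, true, true]) ≤ bitForm η₁ η₂ x := by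
  have key : ∀ d : Bool, ∀ p q : ℝ, (p - sgn d * q) ^ 2 = (q - sgn d * p) ^ 2 := by
    intro d p q
    have : sgn d ^ 2 = 1 := by cases d <;> simp [sgn]
    linear_combination (q ^ 2 - p ^ 2) * this
  rw [bitForm, Finset.sum_comm, oddForm]
  refine Finset.sum_le_sum fun d _ => ?_
  rw [Fin.sum_univ_two, sum_bits, sum_bits]
  have f1 : flipPair 0 ![true, false, false] = ![false, true, false] := by decide
  have f2 : flipPair 0 ![false, true, false] = ![true, false, false] := by decide
  have f3 : flipPair 0 ![false, false, true] = ![true, true, true] := by decide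
  have f4 : flipPair 0 ![true, true, true] = ![false, false, true] := by decide
  have f5 : flipPair 1 ![true, false, false] = ![true, true, true] := by decide
  have f6 : flipPair 1 ![false, true, false] = ![false, false, true] := by decide
  have f7 : flipPair 1 ![false, false, true] = ![false, true, false] := by decide
  have f8 : flipPair 1 ![true, true, true] = ![true, false, false] := by decide
  rw [f1, f2, f3, f4, f5, f6, f7, f8]
  have h1 := key d (detCoord η₁ η₂ 0 d (x ![false, true, false]))
    (detCoord η₁ η₂ 0 d (x ![true, false, false]))
  have h2 := key d (detCoord η₁ η₂ 0 d (x ![true, true, true]))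
    (detCoord η₁ η₂ 0 d (x ![false, false, true]))
  have h3 := key d (detCoord η₁ η₂ 1 d (x ![false, false, true]))
    (detCoord η₁ η₂ 1 d (x ![false, true, false]))
  have h4 := key d (detCoord η₁ η₂ 1 d (x ![true, true, true]))
    (detCoord η₁ η₂ 1 d (x ![true, false, false]))
  rw [h1, h2, h3, h4]
  refine le_trans (le_of_eq ?_)
    (add_le_add (le_add_of_nonneg_left ?_) (le_add_of_nonneg_left ?_))
  · ring
  · positivity
  · positivity

theorem oddForm_eq (η₁ η₂ : ℝ) (h0 : 0 ≤ η₁) (h1 : η₁ ≤ 1) (h0' : 0 ≤ η₂) (h1' : η₂ ≤ 1)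
    (a b g h : Fin 3 → ℝ) :
    oddForm η₁ η₂ a b g h =
      (∑ i, a i ^ 2 + ∑ i, b i ^ 2 + ∑ i, g i ^ 2 + ∑ i, h i ^ 2) / 2 -
      (2 * η₂ - 1) * (η₁ * (a 1 * b 1) - a 0 * b 0 + η₁ * (g 1 * h 1) - g 0 * h 0 +
        b 2 * g 2 - (1 - η₁) * (b 1 * g 1) + a 2 * h 2 - (1 - η₁) * (a 1 * h 1)) -
      2 * √η₂ * √(1 - η₂) * (√η₁ * (a 0 * b 1 + a 1 * b 0 + g 0 * h 1 + g 1 * h 0) +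
        √(1 - η₁) * (b 1 * g 2 + b 2 * g 1 + a 1 * h 2 + a 2 * h 1)) := by
  have e1 := Real.sq_sqrt h0
  have e2 := Real.sq_sqrt (sub_nonneg.2 h1)
  have e3 := Real.sq_sqrt h0'
  have e4 := Real.sq_sqrt (sub_nonneg.2 h1')
  have e5 : 1 - η₁ = √(1 - η₁) ^ 2 := e2.symm
  have e6 : 2 * η₂ - 1 = √η₂ ^ 2 - √(1 - η₂) ^ 2 := by rw [e3, e4]; ring
  simp only [oddForm, Fintype.sum_bool, detCoord, armCoord, sgn, if_true, Bool.false_eq_true,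
    if_false, Fin.sum_univ_three]
  set p := √η₂
  set k := √(1 - η₂)
  set r := √η₁
  set c := √(1 - η₁)
  have e7 : p ^ 2 + k ^ 2 = 1 := by rw [e3, e4]; ring
  have e8 : r ^ 2 + c ^ 2 = 1 := by rw [e1, e2]; ring
  rw [e6, e5, ← e1]
  linear_combination (a 0 ^ 2 + r ^ 2 * a 1 ^ 2 + c ^ 2 * a 1 ^ 2 + a 2 ^ 2 +
    b 0 ^ 2 + r ^ 2 * b 1 ^ 2 + c ^ 2 * b 1 ^ 2 + b 2 ^ 2 +
    g 0 ^ 2 + r ^ 2 * g 1 ^ 2 + c ^ 2 * g 1 ^ 2 + g 2 ^ 2 +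
    h 0 ^ 2 + r ^ 2 * h 1 ^ 2 + c ^ 2 * h 1 ^ 2 + h 2 ^ 2) / 2 * e7 +
    (a 1 ^ 2 + b 1 ^ 2 + g 1 ^ 2 + h 1 ^ 2) / 2 * e8

theorem oddForm_le {η₁ η₂ : ℝ} (h0 : 0 ≤ η₁) (h1 : η₁ ≤ 1) (h0' : 0 ≤ η₂) (h1' : η₂ ≤ 1)
    (a b g h : Fin 3 → ℝ) :
    oddForm η₁ η₂ a b g h ≤ ∑ i, a i ^ 2 + ∑ i, b i ^ 2 + ∑ i, g i ^ 2 + ∑ i, h i ^ 2 := by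
  have key : ∀ d : Bool, ∀ p q : ℝ, (p - sgn d * q) ^ 2 ≤ 2 * p ^ 2 + 2 * q ^ 2 := by
    intro d p q
    have : sgn d ^ 2 = 1 := by cases d <;> simp [sgn]
    nlinarith [sq_nonneg (p + sgn d * q)]
  simp only [← sum_detCoord_sq h0 h1 h0' h1', Fin.sum_univ_two, ← Finset.sum_add_distrib, oddForm]
  refine Finset.sum_le_sum fun d _ => ?_
  linarith [key d (detCoord η₁ η₂ 0 d a) (detCoord η₁ η₂ 0 d b),
    key d (detCoord η₁ η₂ 0 d g) (detCoord η₁ η₂ 0 d h),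
    key d (detCoord η₁ η₂ 1 d b) (detCoord η₁ η₂ 1 d g),
    key d (detCoord η₁ η₂ 1 d a) (detCoord η₁ η₂ 1 d h)]

/-- The coherences between one and three ones: since `0 ≤ eBit ≤ 1`, polarization bounds them by
half the product of the norms, split here with an arbitrary weight `c`. -/
theorem oddForm_cross {η₁ η₂ : ℝ} (h0 : 0 ≤ η₁) (h1 : η₁ ≤ 1) (h0' : 0 ≤ η₂) (h1' : η₂ ≤ 1)
    {c : ℝ} (hc : 0 < c) (a b g h : Fin 3 → ℝ) :
    oddForm η₁ η₂ a b g 0 - (c * (∑ i, a i ^ 2 + ∑ i, b i ^ 2 + ∑ i, g i ^ 2) +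
      (∑ i, h i ^ 2) / c) / 2 ≤ oddForm η₁ η₂ a b g h := by
  obtain ⟨k, m, e, ec, em⟩ : ∃ k m : ℝ, k * m = 1 ∧ c = k ^ 2 ∧ c⁻¹ = m ^ 2 := by
    have e := Real.sq_sqrt hc.le
    exact ⟨√c, (√c)⁻¹, mul_inv_cancel₀ (Real.sqrt_pos.2 hc).ne', e.symm, by rw [inv_pow, e]⟩
  have hle := oddForm_le h0 h1 h0' h1' (k • a) (k • b) (k • g) (-m • h)
  have hpos : 0 ≤ oddForm η₁ η₂ (k • a) (k • b) (k • g) (m • h) :=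
    Finset.sum_nonneg fun d _ => by positivity
  rw [oddForm_eq η₁ η₂ h0 h1 h0' h1'] at hle hpos
  rw [oddForm_eq η₁ η₂ h0 h1 h0' h1', oddForm_eq η₁ η₂ h0 h1 h0' h1', div_eq_mul_inv _ c, em, ec]
  simp only [Fin.sum_univ_three, Pi.smul_apply, Pi.zero_apply, smul_eq_mul] at *
  have hh : 0 ≤ h 0 ^ 2 + h 1 ^ 2 + h 2 ^ 2 := by positivity
  linear_combination (1 / 2) * hpos + (1 / 2) * hle + (1 / 2) * hh -
    ((2 * η₂ - 1) * (η₁ * (g 1 * h 1) - g 0 * h 0 + a 2 * h 2 - (1 - η₁) * (a 1 * h 1)) +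
      2 * √η₂ * √(1 - η₂) * (√η₁ * (g 0 * h 1 + g 1 * h 0) +
        √(1 - η₁) * (a 1 * h 2 + a 2 * h 1))) * e

/-- The two-dimensional blocks that carry the phase errors of a single `1`; `s ≤ 1` is the visibility
`2 √(η₂ (1 - η₂))` of the second beam splitter. -/
theorem two_mul_le_of_lam {y η s u v : ℝ} (hη0 : 0 ≤ η) (hη1 : η ≤ 1) (hs0 : 0 ≤ s)
    (hs1 : s ≤ 1) (hy : 1 ≤ y) (hq : 0 ≤ (1 - η) * y ^ 2 - (1 + η) * y + η) :
    η * u ^ 2 + v ^ 2 ≤ 2 * y * ((u ^ 2 + v ^ 2) / 2 - s * √η * (u * v)) := by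
  have e := Real.sq_sqrt hη0
  set r := √η
  have hD : (y * s * r) ^ 2 ≤ (y - η) * (y - 1) := by
    have h1 : s ^ 2 ≤ 1 := by nlinarith
    have h2 : (y * s * r) ^ 2 ≤ y ^ 2 * η := by
      rw [← e]
      have : 0 ≤ (y * r) ^ 2 * (1 - s ^ 2) := mul_nonneg (sq_nonneg _) (by linarith)
      linarith
    linarith
  have hA : 0 < y - η := by
    rcases (show η ≤ y by linarith).lt_or_eq with h | h
    · linarith
    · exfalso
      have : y = 1 := by linarith
      rw [← h] at hq
      nlinarith
  have h3 : 0 ≤ (y - η) * ((y - η) * u ^ 2 + (y - 1) * v ^ 2 - 2 * (y * s * r) * (u * v)) := by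
    nlinarith [sq_nonneg ((y - η) * u - y * s * r * v), mul_nonneg (sub_nonneg.2 hD) (sq_nonneg v)]
  have h4 := nonneg_of_mul_nonneg_right h3 hA
  linarith

/-- For a single `1`, the phase error form on the left is at most `λ = 2 y` times the bit error form,
up to the imbalance of the second beam splitter. -/
theorem oddForm_one_ge {η₁ η₂ δ₂ y : ℝ} (h0 : 0 ≤ η₁) (h1 : η₁ ≤ 1) (h0' : 0 ≤ η₂) (h1' : η₂ ≤ 1)
    (hl : 1 / 2 - δ₂ ≤ η₂) (hu : η₂ ≤ 1 / 2 + δ₂) (hy : 1 ≤ y)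
    (hq : 0 ≤ (1 - η₁) * y ^ 2 - (1 + η₁) * y + η₁)
    (hq' : 0 ≤ η₁ * y ^ 2 - (2 - η₁) * y + (1 - η₁)) (a b g : Fin 3 → ℝ) :
    η₁ * a 1 ^ 2 + (b 0 ^ 2 + b 2 ^ 2) + (1 - η₁) * g 1 ^ 2 ≤
      2 * y * (oddForm η₁ η₂ a b g 0 +
        2 * δ₂ * (∑ i, a i ^ 2 + ∑ i, b i ^ 2 + ∑ i, g i ^ 2)) := by
  rw [oddForm_eq η₁ η₂ h0 h1 h0' h1']
  simp only [Fin.sum_univ_three, Pi.zero_apply]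
  have e1 := Real.sq_sqrt h0
  have e2 := Real.sq_sqrt (sub_nonneg.2 h1)
  have e3 := Real.sq_sqrt h0'
  have e4 := Real.sq_sqrt (sub_nonneg.2 h1')
  have hs0 : 0 ≤ 2 * √η₂ * √(1 - η₂) := by positivity
  have hs1 : 2 * √η₂ * √(1 - η₂) ≤ 1 := by nlinarith [sq_nonneg (√η₂ - √(1 - η₂))]
  have hb1 := two_mul_le_of_lam h0 h1 hs0 hs1 hy hq (u := a 1) (v := b 0)
  have hb2 := two_mul_le_of_lam (sub_nonneg.2 h1) (by linarith) hs0 hs1 hy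
    (by linarith : 0 ≤ (1 - (1 - η₁)) * y ^ 2 - (1 + (1 - η₁)) * y + (1 - η₁))
    (u := g 1) (v := b 2)
  set s := 2 * √η₂ * √(1 - η₂)
  set r := √η₁
  set c := √(1 - η₁)
  -- The block that carries no phase error is positive.
  have hb3 : 0 ≤ (a 0 ^ 2 + b 1 ^ 2 + g 2 ^ 2) / 2 - s * (r * (a 0 * b 1) + c * (b 1 * g 2)) := by
    have h5 : 0 ≤ (b 1 - s * (r * a 0 + c * g 2)) ^ 2 := sq_nonneg _
    have h6 : (r * a 0 + c * g 2) ^ 2 ≤ a 0 ^ 2 + g 2 ^ 2 := by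
      nlinarith [sq_nonneg (c * a 0 - r * g 2)]
    have h7 : s ^ 2 * (r * a 0 + c * g 2) ^ 2 ≤ 1 * (a 0 ^ 2 + g 2 ^ 2) :=
      mul_le_mul (by nlinarith) h6 (sq_nonneg _) zero_le_one
    nlinarith
  -- The imbalance of the second beam splitter costs at most `δ₂`.
  have hb4 : 0 ≤ 2 * δ₂ * (a 0 ^ 2 + a 1 ^ 2 + a 2 ^ 2 + (b 0 ^ 2 + b 1 ^ 2 + b 2 ^ 2) +
      (g 0 ^ 2 + g 1 ^ 2 + g 2 ^ 2)) - (2 * η₂ - 1) *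
      (η₁ * (a 1 * b 1) - a 0 * b 0 + b 2 * g 2 - (1 - η₁) * (b 1 * g 1)) := by
    have h8 : |η₁ * (a 1 * b 1) - a 0 * b 0 + b 2 * g 2 - (1 - η₁) * (b 1 * g 1)| ≤
        a 0 ^ 2 + a 1 ^ 2 + a 2 ^ 2 + (b 0 ^ 2 + b 1 ^ 2 + b 2 ^ 2) +
          (g 0 ^ 2 + g 1 ^ 2 + g 2 ^ 2) := by
      have h1'' := sub_nonneg.2 h1
      have hn : 0 ≤ (a 0 ^ 2 + b 0 ^ 2 + b 2 ^ 2 + g 2 ^ 2 + a 1 ^ 2 + b 1 ^ 2 + g 1 ^ 2) / 2 +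
          a 2 ^ 2 + g 0 ^ 2 := by positivity
      have hn' := add_nonneg (mul_nonneg h1'' (sq_nonneg (a 1))) (mul_nonneg h0 (sq_nonneg (g 1)))
      have k1 := mul_nonneg h0 (sq_nonneg (a 1 + b 1))
      have k2 := mul_nonneg h0 (sq_nonneg (a 1 - b 1))
      have k3 := mul_nonneg h1'' (sq_nonneg (b 1 + g 1))
      have k4 := mul_nonneg h1'' (sq_nonneg (b 1 - g 1))
      refine abs_le.2 ⟨?_, ?_⟩
      · linear_combination (k1 + k4 + sq_nonneg (a 0 - b 0) + sq_nonneg (b 2 + g 2)) / 2 +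
          hn + hn' / 2
      · linear_combination (k2 + k3 + sq_nonneg (a 0 + b 0) + sq_nonneg (b 2 - g 2)) / 2 +
          hn + hn' / 2
    have h9 : |2 * η₂ - 1| ≤ 2 * δ₂ := abs_le.2 ⟨by linarith, by linarith⟩
    have h10 := mul_le_mul h9 h8 (abs_nonneg _) (by linarith [abs_nonneg (2 * η₂ - 1)])
    rw [← abs_mul] at h10
    linarith [le_abs_self ((2 * η₂ - 1) *
      (η₁ * (a 1 * b 1) - a 0 * b 0 + b 2 * g 2 - (1 - η₁) * (b 1 * g 1)))]
  have hrest : 0 ≤ a 2 ^ 2 + g 0 ^ 2 := by positivity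
  have hy2 : 0 ≤ 2 * y := by linarith
  linear_combination hb1 + hb2 + (2 * y) * hb3 + (2 * y) * hb4 + y * hrest

/-- The weight of Alice's outcome `z` in the bound on the phase error operator: the split coherence
between one and three ones, and the outcomes with two and more ones, where the phase error
probability is bounded by one. -/
def zWeight (l c : ℝ) (z : Fin 3 → Bool) : ℝ :=
  l / 2 * ((if numOnes z = 1 then c else 0) + if numOnes z = 3 then c⁻¹ else 0) +
    if 2 ≤ numOnes z then 1 else 0

/-- The bound on the phase error operator in terms of the quadratic forms. -/
theorem sum_phForm_le {η₁ η₂ δ₁ δ₂ c : ℝ} (hδ₁ : 0 ≤ δ₁) (hδ₁' : δ₁ < 1 / 2) (hδ₂ : 0 ≤ δ₂)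
    (hδ₂' : δ₂ < 1 / 2) (h₁ : η₁ ∈ Set.Icc (1 / 2 - δ₁) (1 / 2 + δ₁))
    (h₂ : η₂ ∈ Set.Icc (1 / 2 - δ₂) (1 / 2 + δ₂)) (hc : 0 < c)
    (x : (Fin 3 → Bool) → Fin 3 → ℝ) :
    ∑ z, phForm η₁ z (x z) ≤
      lam (1 / 2 + δ₁) (1 / 2 + δ₂) * (bitForm η₁ η₂ x + 2 * δ₂ * ∑ z, ∑ i, x z i ^ 2) +
      ∑ z, zWeight (lam (1 / 2 + δ₁) (1 / 2 + δ₂)) c z * ∑ i, x z i ^ 2 := by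
  obtain ⟨hl₁, hu₁⟩ := h₁
  obtain ⟨hl₂, hu₂⟩ := h₂
  have h0 : 0 ≤ η₁ := by linarith
  have h1 : η₁ ≤ 1 := by linarith
  have h0' : 0 ≤ η₂ := by linarith
  have h1' : η₂ ≤ 1 := by linarith
  obtain ⟨hy, hq⟩ := lam_half_spec (h := 1 / 2 + δ₁) (h₂ := 1 / 2 + δ₂) (by linarith)
    (by linarith) (by linarith) (by linarith)
  set l := lam (1 / 2 + δ₁) (1 / 2 + δ₂)
  -- The quadratic decreases with its parameter, so it is nonnegative at `η₁` and at `1 - η₁` too.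
  have hmono : 0 ≤ (l / 2) ^ 2 + l / 2 - 1 := by nlinarith
  have hq₁ : 0 ≤ (1 - η₁) * (l / 2) ^ 2 - (1 + η₁) * (l / 2) + η₁ := by
    nlinarith [mul_nonneg (by linarith : 0 ≤ 1 / 2 + δ₁ - η₁) hmono]
  have hq₂ : 0 ≤ η₁ * (l / 2) ^ 2 - (2 - η₁) * (l / 2) + (1 - η₁) := by
    nlinarith [mul_nonneg (by linarith : 0 ≤ 1 / 2 + δ₁ - (1 - η₁)) hmono]
  have hl0 : 0 ≤ l := by linarith
  have hbit := (oddForm_cross h0 h1 h0' h1' hc (x ![true, false, false]) (x ![false, true, false])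
    (x ![false, false, true]) (x ![true, true, true])).trans (oddForm_le_bitForm η₁ η₂ x)
  have hone := oddForm_one_ge h0 h1 h0' h1' hl₂ hu₂ hy hq₁ hq₂ (x ![true, false, false])
    (x ![false, true, false]) (x ![false, false, true])
  have e0 : phForm η₁ ![false, false, false] (x ![false, false, false]) = 0 := by
    simp [phForm, predict]
  have e1 : phForm η₁ ![true, false, false] (x ![true, false, false]) =
      η₁ * x ![true, false, false] 1 ^ 2 := by
    simp [phForm, predict, armCoord, mul_pow, Real.sq_sqrt h0]
  have e2 : phForm η₁ ![false, true, false] (x ![false, true, false]) =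
      x ![false, true, false] 0 ^ 2 + x ![false, true, false] 2 ^ 2 := by
    simp [phForm, predict, armCoord]
  have e3 : phForm η₁ ![false, false, true] (x ![false, false, true]) =
      (1 - η₁) * x ![false, false, true] 1 ^ 2 := by
    simp [phForm, predict, armCoord, mul_pow, Real.sq_sqrt (sub_nonneg.2 h1)]
  have l1 := phForm_le h0 h1 ![true, true, false] (x ![true, true, false])
  have l2 := phForm_le h0 h1 ![true, false, true] (x ![true, false, true])
  have l3 := phForm_le h0 h1 ![false, true, true] (x ![false, true, true])
  have l4 := phForm_le h0 h1 ![true, true, true] (x ![true, true, true])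
  have n0 : numOnes ![false, false, false] = 0 := by decide
  have n1 : numOnes ![true, false, false] = 1 := by decide
  have n2 : numOnes ![false, true, false] = 1 := by decide
  have n3 : numOnes ![false, false, true] = 1 := by decide
  have n4 : numOnes ![true, true, false] = 2 := by decide
  have n5 : numOnes ![true, false, true] = 2 := by decide
  have n6 : numOnes ![false, true, true] = 2 := by decide
  have n7 : numOnes ![true, true, true] = 3 := by decide
  simp only [sum_bits, zWeight, e0, e1, e2, e3, n0, n1, n2, n3, n4, n5, n6, n7]
  norm_num
  have p : ∀ z, 0 ≤ ∑ i, x z i ^ 2 := fun z => Finset.sum_nonneg fun i _ => sq_nonneg _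
  have hd : 0 ≤ l * (2 * δ₂) := by positivity
  have hm := mul_le_mul_of_nonneg_left hbit hl0
  rw [div_eq_mul_inv] at hm
  linear_combination hone + hm + l1 + l2 + l3 + l4 + mul_nonneg hd (p ![false, false, false]) +
    mul_nonneg hd (p ![true, true, false]) + mul_nonneg hd (p ![true, false, true]) +
    mul_nonneg hd (p ![false, true, true]) + mul_nonneg hd (p ![true, true, true])

/-! ### One block: operators -/

/-- `(1 ⊗ ⟨w|) v` for a vector `v` of Alice's qubits and Bob's photon. -/
def partialInner (w : Fin 3 → ℂ) (v : (Fin 3 → Bool) × Fin 3 → ℂ) (z : Fin 3 → Bool) : ℂ :=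
  ∑ i, star (w i) * v (z, i)

theorem dotProduct_kronecker_proj_mulVec (A : Matrix (Fin 3 → Bool) (Fin 3 → Bool) ℂ)
    (w : Fin 3 → ℂ) (v : (Fin 3 → Bool) × Fin 3 → ℂ) :
    star v ⬝ᵥ (A ⊗ₖ proj w).mulVec v =
      ∑ z, ∑ z', star (partialInner w v z) * A z z' * partialInner w v z' := by
  simp only [dotProduct, Matrix.mulVec, Fintype.sum_prod_type, Matrix.kroneckerMap_apply, proj,
    Matrix.vecMulVec_apply, partialInner, Pi.star_apply, star_sum, star_mul', star_star,
    Finset.mul_sum, Finset.sum_mul]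
  refine Finset.sum_congr rfl fun z _ => ?_
  rw [Finset.sum_comm]
  refine Finset.sum_congr rfl fun z' _ => ?_
  rw [Finset.sum_comm]
  refine Finset.sum_congr rfl fun i _ => Finset.sum_congr rfl fun k _ => ?_
  ring

theorem partialInner_armVec (η₁ : ℝ) (j : Fin 2) (up : Bool)
    (v : (Fin 3 → Bool) × Fin 3 → ℂ) (z : Fin 3 → Bool) :
    partialInner (armVec η₁ j up) v z = ⟨armCoord η₁ j up fun i => (v (z, i)).re,
      armCoord η₁ j up fun i => (v (z, i)).im⟩ := by
  apply Complex.ext <;> fin_cases j <;> cases up <;>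
    simp [partialInner, Fin.sum_univ_three, armVec, armCoord, Pi.single_apply]

theorem partialInner_detVec (η₁ η₂ : ℝ) (j : Fin 2) (d : Bool)
    (v : (Fin 3 → Bool) × Fin 3 → ℂ) (z : Fin 3 → Bool) :
    partialInner (detVec η₁ η₂ j d) v z = ⟨detCoord η₁ η₂ j d fun i => (v (z, i)).re,
      detCoord η₁ η₂ j d fun i => (v (z, i)).im⟩ := by
  have h1 := partialInner_armVec η₁ j true v z
  have h2 := partialInner_armVec η₁ j false v z
  have e : partialInner (detVec η₁ η₂ j d) v z =
      if d then (√η₂ : ℂ) * partialInner (armVec η₁ j true) v z -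
        (√(1 - η₂) : ℂ) * partialInner (armVec η₁ j false) v z
      else (√η₂ : ℂ) * partialInner (armVec η₁ j false) v z +
        (√(1 - η₂) : ℂ) * partialInner (armVec η₁ j true) v z := by
    cases d <;> simp [partialInner, detVec, Fin.sum_univ_three] <;> ring
  rw [e, h1, h2]
  apply Complex.ext <;> cases d <;> simp [detCoord]

theorem sum_proj_single_apply (F : Finset (Fin 3 → Bool)) (a b : Fin 3 → Bool) :
    (∑ z ∈ F, proj (Pi.single z (1 : ℂ))) a b = if b = a then (if a ∈ F then 1 else 0) else 0 := by
  simp only [Matrix.sum_apply, proj, Matrix.vecMulVec_apply, Pi.star_apply, Pi.single_apply]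
  split_ifs with h1 h2
  · subst h1
    rw [Finset.sum_eq_single_of_mem b h2]
    · simp
    · intro z _ hz
      simp [hz.symm]
  · subst h1
    exact Finset.sum_eq_zero fun z hz => by
      have : b ≠ z := fun h => h2 (h ▸ hz)
      simp [this]
  · refine Finset.sum_eq_zero fun z hz => ?_
    by_cases h : a = z
    · subst h; simp [h1]
    · simp [h]

/-- All matrices in sight are real, so that the real and the imaginary part of the vector contribute
separately. -/
theorem dotProduct_ePh_mulVec (η₁ : ℝ) (v : (Fin 3 → Bool) × Fin 3 → ℂ) :
    star v ⬝ᵥ (ePh η₁).mulVec v = ((∑ z, phForm η₁ z (fun i => (v (z, i)).re) +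
      ∑ z, phForm η₁ z (fun i => (v (z, i)).im) : ℝ) : ℂ) := by
  simp only [ePh, Matrix.sum_mulVec, dotProduct_sum, dotProduct_kronecker_proj_mulVec,
    sum_proj_single_apply, mul_ite, mul_zero, ite_mul, zero_mul, Finset.sum_ite_eq',
    Finset.mem_univ, if_true, Finset.mem_filter, true_and,
    partialInner_armVec, phForm]
  rw [← Finset.sum_add_distrib]
  simp only [← Finset.sum_add_distrib]
  conv_rhs => rw [Finset.sum_comm, Complex.ofReal_sum]
  refine Finset.sum_congr rfl fun j _ => ?_
  conv_rhs => rw [Finset.sum_comm, Complex.ofReal_sum]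
  refine Finset.sum_congr rfl fun up _ => ?_
  rw [Complex.ofReal_sum]
  refine Finset.sum_congr rfl fun z _ => ?_
  split_ifs
  · apply Complex.ext
    · simp [pow_two]
    · simp [pow_two]
      ring
  · simp

/-- The signs in the matrix `√2 H`. -/
def hadSign (z b : Bool) : ℤ := if z && b then -1 else 1

theorem had_mul_star_had (z z' b : Bool) :
    had z b * star (had z' b) = ((hadSign z b * hadSign z' b : ℤ) : ℂ) / 2 := by
  have h2 : ((√2 : ℝ) : ℂ) * (√2 : ℝ) = 2 := by
    rw [← Complex.ofReal_mul, Real.mul_self_sqrt (by norm_num)]; simp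
  have hs : ∀ z b, had z b = (hadSign z b : ℂ) / (√2 : ℝ) := by
    intro z b
    cases z <;> cases b <;> simp [had, hadSign]
  rw [hs, hs, star_div₀, RCLike.star_def, Complex.conj_ofReal, div_mul_div_comm,
    h2, map_intCast]
  push_cast
  rfl

/-- The projector onto `b_j ⊕ b_{j+1} ≠ d` is `(1 - (-1)^d X_j X_{j+1}) / 2`, checked on the integer
matrix elements of `8` times the projector. -/
theorem sum_prod_hadSign (j : Fin 2) (d : Bool) (a b : Fin 3 → Bool) :
    ∑ c : Fin 3 → Bool with (c j.castSucc ^^ c j.succ) ≠ d,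
      ∏ i, (hadSign (a i) (c i) * hadSign (b i) (c i)) =
    4 * ((if b = a then 1 else 0) -
      (if d then -1 else 1) * if b = flipPair j a then 1 else 0) := by
  revert j d a b
  decide +kernel

/-- The sum of the projectors onto the `X`-basis states with a given parity of two bits. -/
theorem sum_proj_hadVec_apply (j : Fin 2) (d : Bool) (a b : Fin 3 → Bool) :
    (∑ c : Fin 3 → Bool with (c j.castSucc ^^ c j.succ) ≠ d, proj (hadVec c)) a b =
      ((if b = a then 1 else 0) - sgn d * if b = flipPair j a then 1 else 0) / 2 := by
  have h := congrArg (fun n : ℤ => (n : ℂ) / 8) (sum_prod_hadSign j d a b)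
  simp only [Matrix.sum_apply, proj, Matrix.vecMulVec_apply, hadVec, Pi.star_apply, star_prod,
    ← Finset.prod_mul_distrib, had_mul_star_had, Finset.prod_div_distrib]
  simp only [Int.cast_sum, Finset.sum_div, Int.cast_prod] at h
  norm_num at h ⊢
  rw [h]
  cases d <;> simp [sgn] <;> ring

theorem dotProduct_eBit_mulVec (η₁ η₂ : ℝ) (v : (Fin 3 → Bool) × Fin 3 → ℂ) :
    star v ⬝ᵥ (eBit η₁ η₂).mulVec v = ((bitForm η₁ η₂ (fun z i => (v (z, i)).re) +
      bitForm η₁ η₂ (fun z i => (v (z, i)).im) : ℝ) : ℂ) := by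
  simp only [eBit, Matrix.sum_mulVec, dotProduct_sum, dotProduct_kronecker_proj_mulVec,
    sum_proj_hadVec_apply, bitForm, partialInner_detVec]
  push_cast
  rw [← Finset.sum_add_distrib]
  refine Finset.sum_congr rfl fun j _ => ?_
  rw [← Finset.sum_add_distrib]
  refine Finset.sum_congr rfl fun d _ => ?_
  rw [← Finset.sum_add_distrib]
  set y : (Fin 3 → Bool) → ℂ := fun z => ⟨detCoord η₁ η₂ j d fun i => (v (z, i)).re,
    detCoord η₁ η₂ j d fun i => (v (z, i)).im⟩ with hy
  have hf : ∀ g : (Fin 3 → Bool) → ℂ, ∑ z, g (flipPair j z) = ∑ z, g z := fun g =>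
    Equiv.sum_comp (flipPair_involutive j).toPerm g
  have hl : ∀ z, ∑ z', star (y z) * (((if z' = z then 1 else 0) -
      (sgn d : ℂ) * if z' = flipPair j z then 1 else 0) / 2) * y z' =
      (star (y z) * y z - sgn d * (star (y z) * y (flipPair j z))) / 2 := by
    intro z
    have : ∀ z', star (y z) * (((if z' = z then 1 else 0) -
        (sgn d : ℂ) * if z' = flipPair j z then 1 else 0) / 2) * y z' =
        (if z' = z then star (y z) * y z' / 2 else 0) -
        if z' = flipPair j z then sgn d * (star (y z) * y z') / 2 else 0 := by
      intro z'
      split_ifs <;> ring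
    simp only [this, Finset.sum_sub_distrib, Finset.sum_ite_eq', Finset.mem_univ, if_true]
    ring
  have hr : ∀ z, ((((detCoord η₁ η₂ j d fun i => (v (z, i)).re) : ℂ) -
      sgn d * (detCoord η₁ η₂ j d fun i => (v (flipPair j z, i)).re : ℝ)) ^ 2 / 4 +
      (((detCoord η₁ η₂ j d fun i => (v (z, i)).im) : ℂ) -
      sgn d * (detCoord η₁ η₂ j d fun i => (v (flipPair j z, i)).im : ℝ)) ^ 2 / 4) =
      (star (y z) * y z - sgn d * (star (y z) * y (flipPair j z))) / 4 +
      (star (y (flipPair j z)) * y (flipPair j z) -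
        sgn d * (star (y (flipPair j z)) * y z)) / 4 := by
    intro z
    apply Complex.ext <;> cases d <;> simp [hy, sgn, pow_two] <;> ring
  simp only [hr]
  rw [Finset.sum_add_distrib]
  have h2 := hf fun z => (star (y z) * y z - sgn d * (star (y z) * y (flipPair j z))) / 4
  simp only [flipPair_involutive j _] at h2
  rw [h2, ← Finset.sum_add_distrib]
  refine Finset.sum_congr rfl fun z _ => ?_
  rw [← add_div, hl]
  ring

theorem proj_posSemidef {n : Type*} [Fintype n] (v : n → ℂ) : (proj v).PosSemidef :=
  Matrix.posSemidef_vecMulVec_self_star v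

theorem ePh_posSemidef (η₁ : ℝ) : (ePh η₁).PosSemidef :=
  Matrix.posSemidef_sum _ fun _ _ => Matrix.posSemidef_sum _ fun _ _ =>
    (Matrix.posSemidef_sum _ fun _ _ => proj_posSemidef _).kronecker (proj_posSemidef _)

theorem eBit_posSemidef (η₁ η₂ : ℝ) : (eBit η₁ η₂).PosSemidef :=
  Matrix.posSemidef_sum _ fun _ _ => Matrix.posSemidef_sum _ fun _ _ =>
    (Matrix.posSemidef_sum _ fun _ _ => proj_posSemidef _).kronecker (proj_posSemidef _)

theorem dotProduct_diagonal_mulVec (W : (Fin 3 → Bool) → ℝ) (v : (Fin 3 → Bool) × Fin 3 → ℂ) :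
    star v ⬝ᵥ (Matrix.diagonal fun x => (W x.1 : ℂ)).mulVec v =
      ((∑ z, W z * ∑ i, (v (z, i)).re ^ 2 + ∑ z, W z * ∑ i, (v (z, i)).im ^ 2 : ℝ) : ℂ) := by
  rw [← Finset.sum_add_distrib, Complex.ofReal_sum]
  simp only [dotProduct, Matrix.mulVec_diagonal, Fintype.sum_prod_type]
  refine Finset.sum_congr rfl fun z _ => ?_
  rw [← mul_add, ← Finset.sum_add_distrib, Finset.mul_sum, Complex.ofReal_sum]
  refine Finset.sum_congr rfl fun i _ => ?_
  apply Complex.ext <;> simp [pow_two] <;> ring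

theorem dotProduct_one_mulVec (v : (Fin 3 → Bool) × Fin 3 → ℂ) :
    star v ⬝ᵥ (1 : Matrix ((Fin 3 → Bool) × Fin 3) ((Fin 3 → Bool) × Fin 3) ℂ).mulVec v =
      ((∑ z, ∑ i, (v (z, i)).re ^ 2 + ∑ z, ∑ i, (v (z, i)).im ^ 2 : ℝ) : ℂ) := by
  have := dotProduct_diagonal_mulVec (fun _ => 1) v
  simp only [one_mul, Complex.ofReal_one, Matrix.diagonal_one] at this
  exact this

theorem one_sub_ePh_posSemidef {η₁ : ℝ} (h0 : 0 ≤ η₁) (h1 : η₁ ≤ 1) : (1 - ePh η₁).PosSemidef := by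
  refine .of_dotProduct_mulVec_nonneg (Matrix.isHermitian_one.sub (ePh_posSemidef η₁).1)
    fun v => ?_
  rw [Matrix.sub_mulVec, dotProduct_sub, dotProduct_one_mulVec, dotProduct_ePh_mulVec,
    ← Complex.ofReal_sub, Complex.zero_le_real]
  have hr := Finset.sum_le_sum fun z (_ : z ∈ Finset.univ) =>
    phForm_le h0 h1 z fun i => (v (z, i)).re
  have hi := Finset.sum_le_sum fun z (_ : z ∈ Finset.univ) =>
    phForm_le h0 h1 z fun i => (v (z, i)).im
  linarith

theorem one_sub_eBit_posSemidef {η₁ η₂ : ℝ} (h0 : 0 ≤ η₁) (h1 : η₁ ≤ 1) (h0' : 0 ≤ η₂)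
    (h1' : η₂ ≤ 1) : (1 - eBit η₁ η₂).PosSemidef := by
  refine .of_dotProduct_mulVec_nonneg (Matrix.isHermitian_one.sub (eBit_posSemidef η₁ η₂).1)
    fun v => ?_
  rw [Matrix.sub_mulVec, dotProduct_sub, dotProduct_one_mulVec, dotProduct_eBit_mulVec,
    ← Complex.ofReal_sub, Complex.zero_le_real]
  have hr := bitForm_le h0 h1 h0' h1' fun z i => (v (z, i)).re
  have hi := bitForm_le h0 h1 h0' h1' fun z i => (v (z, i)).im
  linarith

theorem smul_le_smul_of_scalar_le {n : Type*} [Fintype n] {A : Matrix n n ℂ} (hA : A.PosSemidef)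
    {r s : ℝ} (h : r ≤ s) : (r : ℂ) • A ≤ (s : ℂ) • A := by
  rw [Matrix.le_iff, ← sub_smul, ← Complex.ofReal_sub]
  exact hA.smul (Complex.zero_le_real.2 (sub_nonneg.2 h))

theorem smul_le_smul_of_matrix_le {n : Type*} [Fintype n] {A B : Matrix n n ℂ} (h : A ≤ B)
    {r : ℝ} (hr : 0 ≤ r) : (r : ℂ) • A ≤ (r : ℂ) • B := by
  rw [Matrix.le_iff, ← smul_sub]
  exact (Matrix.le_iff.1 h).smul (Complex.zero_le_real.2 hr)

/-- The phase error operator is bounded by the bit error operator, up to the imbalance of the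
beam splitters and weights on Alice's `Z`-basis outcomes. -/
theorem ePh_sub_le {η₁ η₂ δ₁ δ₂ c : ℝ} (hδ₁ : 0 ≤ δ₁) (hδ₁' : δ₁ < 1 / 2) (hδ₂ : 0 ≤ δ₂)
    (hδ₂' : δ₂ < 1 / 2) (h₁ : η₁ ∈ Set.Icc (1 / 2 - δ₁) (1 / 2 + δ₁))
    (h₂ : η₂ ∈ Set.Icc (1 / 2 - δ₂) (1 / 2 + δ₂)) (hc : 0 < c) :
    ePh η₁ - (lam (1 / 2 + δ₁) (1 / 2 + δ₂) : ℂ) • eBit η₁ η₂ -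
      ((2 * lam (1 / 2 + δ₁) (1 / 2 + δ₂) * δ₂ : ℝ) : ℂ) • 1 ≤
      Matrix.diagonal fun x => (zWeight (lam (1 / 2 + δ₁) (1 / 2 + δ₂)) c x.1 : ℂ) := by
  set l := lam (1 / 2 + δ₁) (1 / 2 + δ₂) with hl
  have hreal : ∀ r : ℝ, star (r : ℂ) = r := Complex.conj_ofReal
  rw [Matrix.le_iff]
  refine .of_dotProduct_mulVec_nonneg (Matrix.IsHermitian.sub ?_ (((ePh_posSemidef η₁).1.sub
    ?_).sub ?_)) fun v => ?_
  · exact Matrix.isHermitian_diagonal_of_self_adjoint _ (funext fun x => hreal _)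
  · rw [Matrix.IsHermitian, Matrix.conjTranspose_smul, hreal, (eBit_posSemidef η₁ η₂).1]
  · rw [Matrix.IsHermitian, Matrix.conjTranspose_smul, hreal, Matrix.conjTranspose_one]
  · simp only [Matrix.sub_mulVec, dotProduct_sub, Matrix.smul_mulVec, dotProduct_smul,
      dotProduct_one_mulVec, dotProduct_ePh_mulVec, dotProduct_eBit_mulVec,
      dotProduct_diagonal_mulVec, smul_eq_mul, ← Complex.ofReal_sub, ← Complex.ofReal_mul]
    rw [Complex.zero_le_real]
    have hr := sum_phForm_le hδ₁ hδ₁' hδ₂ hδ₂' h₁ h₂ hc fun z i => (v (z, i)).re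
    have hi := sum_phForm_le hδ₁ hδ₁' hδ₂ hδ₂' h₁ h₂ hc fun z i => (v (z, i)).im
    rw [← hl] at hr hi
    linarith

/-! ### Exponential moments -/

/-- The POVM of a detected block on Alice's qubits and Bob's photon. -/
def detPOVM (t η₁ η₂ : ℝ) : Bool ⊕ Bool → Matrix ((Fin 3 → Bool) × Fin 3) ((Fin 3 → Bool) × Fin 3) ℂ
  | Sum.inl true => (t : ℂ) • ePh η₁
  | Sum.inl false => (t : ℂ) • (1 - ePh η₁)
  | Sum.inr true => ((1 - t : ℝ) : ℂ) • eBit η₁ η₂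
  | Sum.inr false => ((1 - t : ℝ) : ℂ) • (1 - eBit η₁ η₂)

theorem blockPOVM_some (t η₁ η₂ : ℝ) (e : Bool ⊕ Bool) :
    blockPOVM t η₁ η₂ (some e) = onDetected (detPOVM t η₁ η₂ e) := by
  rcases e with (_ | _) | (_ | _) <;> exact (onDetected_smul _ _).symm

theorem detPOVM_posSemidef {t η₁ η₂ : ℝ} (ht0 : 0 ≤ t) (ht1 : t ≤ 1) (h0 : 0 ≤ η₁) (h1 : η₁ ≤ 1)
    (h0' : 0 ≤ η₂) (h1' : η₂ ≤ 1) (e : Bool ⊕ Bool) : (detPOVM t η₁ η₂ e).PosSemidef := by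
  have p0 : (0 : ℂ) ≤ (t : ℂ) := Complex.zero_le_real.2 ht0
  have p1 : (0 : ℂ) ≤ ((1 - t : ℝ) : ℂ) := Complex.zero_le_real.2 (sub_nonneg.2 ht1)
  rcases e with (_ | _) | (_ | _)
  · exact (one_sub_ePh_posSemidef h0 h1).smul p0
  · exact (ePh_posSemidef η₁).smul p0
  · exact (one_sub_eBit_posSemidef h0 h1 h0' h1').smul p1
  · exact (eBit_posSemidef η₁ η₂).smul p1

theorem sum_smul_detPOVM (t η₁ η₂ : ℝ) (f : Bool ⊕ Bool → ℝ) :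
    ∑ e, (f e : ℂ) • detPOVM t η₁ η₂ e =
      ((t * (f (.inl true) - f (.inl false)) : ℝ) : ℂ) • ePh η₁ +
      (((1 - t) * (f (.inr true) - f (.inr false)) : ℝ) : ℂ) • eBit η₁ η₂ +
      ((t * f (.inl false) + (1 - t) * f (.inr false) : ℝ) : ℂ) • 1 := by
  simp only [Fintype.sum_sum_type, Fintype.sum_bool, detPOVM]
  push_cast
  module

theorem blockPOVM_posSemidef {t η₁ η₂ : ℝ} (ht0 : 0 ≤ t) (ht1 : t ≤ 1) (h0 : 0 ≤ η₁)
    (h1 : η₁ ≤ 1) (h0' : 0 ≤ η₂) (h1' : η₂ ≤ 1) (o : Outcome) :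
    (blockPOVM t η₁ η₂ o).PosSemidef := by
  rcases o with _ | e
  · exact notDetected_posSemidef
  · rw [blockPOVM_some]
    exact onDetected_posSemidef (detPOVM_posSemidef ht0 ht1 h0 h1 h0' h1' e)

theorem onDetected_diagonal (d : (Fin 3 → Bool) → ℂ) :
    onDetected (Matrix.diagonal fun x => d x.1) =
      Matrix.diagonal fun x => if x.2 = none then 0 else d x.1 := by
  ext ⟨z, i⟩ ⟨z', i'⟩
  by_cases h : ((z, i) : Blk) = (z', i')
  · cases h
    rcases i with _ | i
    · simp [onDetected]
    · simp [onDetected]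
  · rw [Matrix.diagonal_apply_ne _ h]
    rcases i with _ | i
    · rfl
    · rcases i' with _ | i'
      · rfl
      · exact Matrix.diagonal_apply_ne _ fun h' => h (by simp_all)

/-- The factor contributed by one block to the exponential moment of `∑ f`; the term `(θ B)²`
compensates for the second order in each detected block. -/
def expWeight (θ B : ℝ) (f : Bool ⊕ Bool → ℝ) : Outcome → ℝ
  | none => 1
  | some e => Real.exp (θ * f e - (θ * B) ^ 2)

theorem expWeight_nonneg (θ B : ℝ) (f : Bool ⊕ Bool → ℝ) (o : Outcome) :
    0 ≤ expWeight θ B f o := by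
  rcases o with _ | e
  · exact zero_le_one
  · exact (Real.exp_pos _).le

/-- The moment operator of one block is at most `1 + θ W` if the mean of `f` is at most `W`. -/
theorem sum_expWeight_smul_le {t η₁ η₂ θ B : ℝ} (ht0 : 0 ≤ t) (ht1 : t ≤ 1) (h0 : 0 ≤ η₁)
    (h1 : η₁ ≤ 1) (h0' : 0 ≤ η₂) (h1' : η₂ ≤ 1) (hθ : 0 ≤ θ) {f : Bool ⊕ Bool → ℝ}
    (hf : ∀ e, |f e| ≤ B) (hB : θ * B ≤ 1) {W : (Fin 3 → Bool) → ℝ} (hW : ∀ z, 0 ≤ W z)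
    (hfW : ∑ e, (f e : ℂ) • detPOVM t η₁ η₂ e ≤ Matrix.diagonal fun x => (W x.1 : ℂ)) :
    ∑ o, (expWeight θ B f o : ℂ) • blockPOVM t η₁ η₂ o ≤
      Matrix.diagonal fun x => ((1 + θ * W x.1 : ℝ) : ℂ) := by
  have hP := detPOVM_posSemidef ht0 ht1 h0 h1 h0' h1'
  set κ := (θ * B) ^ 2 with hκ
  have hB0 : 0 ≤ B := (abs_nonneg _).trans (hf (.inl true))
  have hκ0 : 0 ≤ κ := sq_nonneg _
  -- `exp (θ f - κ) ≤ exp (-κ) (1 + κ + θ f)`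
  have hexp : ∀ e, expWeight θ B f (some e) ≤ Real.exp (-κ) * (1 + κ) + Real.exp (-κ) * θ * f e := by
    intro e
    have hle : |θ * f e| ≤ θ * B := by
      rw [abs_mul, abs_of_nonneg hθ]
      exact mul_le_mul_of_nonneg_left (hf e) hθ
    have h2 := (abs_le.1 (Real.abs_exp_sub_one_sub_id_le (hle.trans hB))).2
    have h3 : (θ * f e) ^ 2 ≤ κ := by
      rw [hκ, ← sq_abs]
      exact pow_le_pow_left₀ (abs_nonneg _) hle 2
    have h4 : expWeight θ B f (some e) = Real.exp (-κ) * Real.exp (θ * f e) := by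
      rw [← Real.exp_add]
      change Real.exp (θ * f e - κ) = _
      congr 1
      ring
    rw [h4]
    nlinarith [Real.exp_pos (-κ)]
  have hκ1 : Real.exp (-κ) * (1 + κ) ≤ 1 := by
    rw [Real.exp_neg, inv_mul_le_iff₀ (Real.exp_pos κ), mul_one, add_comm]
    exact Real.add_one_le_exp κ
  have hκ2 : Real.exp (-κ) ≤ 1 := Real.exp_le_one_iff.2 (by linarith)
  have hdiag : (Matrix.diagonal fun x : (Fin 3 → Bool) × Fin 3 => (W x.1 : ℂ)).PosSemidef :=
    Matrix.PosSemidef.diagonal fun x => Complex.zero_le_real.2 (hW x.1)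
  have hdet : ∑ e, (expWeight θ B f (some e) : ℂ) • detPOVM t η₁ η₂ e ≤
      Matrix.diagonal fun x => ((1 + θ * W x.1 : ℝ) : ℂ) := by
    have hsum : ∑ e, detPOVM t η₁ η₂ e = 1 := by
      have := sum_smul_detPOVM t η₁ η₂ fun _ => 1
      simpa using this
    have hone := smul_le_smul_of_scalar_le
      (Matrix.PosSemidef.one (n := (Fin 3 → Bool) × Fin 3) (R := ℂ)) hκ1
    have hθκ : Real.exp (-κ) * θ ≤ θ := mul_le_of_le_one_left hθ hκ2
    have hfst := smul_le_smul_of_matrix_le hfW (mul_nonneg (Real.exp_pos (-κ)).le hθ)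
    have htr := le_trans hfst (smul_le_smul_of_scalar_le hdiag hθκ)
    calc ∑ e, (expWeight θ B f (some e) : ℂ) • detPOVM t η₁ η₂ e
        ≤ ∑ e, ((Real.exp (-κ) * (1 + κ) + Real.exp (-κ) * θ * f e : ℝ) : ℂ) •
            detPOVM t η₁ η₂ e :=
          Finset.sum_le_sum fun e _ => smul_le_smul_of_scalar_le (hP e) (hexp e)
      _ = ((Real.exp (-κ) * (1 + κ) : ℝ) : ℂ) • 1 + ((Real.exp (-κ) * θ : ℝ) : ℂ) •
            ∑ e, (f e : ℂ) • detPOVM t η₁ η₂ e := by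
          rw [← hsum, Finset.smul_sum, Finset.smul_sum, ← Finset.sum_add_distrib]
          refine Finset.sum_congr rfl fun e _ => ?_
          rw [smul_smul, ← add_smul]
          push_cast
          rfl
      _ ≤ ((1 : ℝ) : ℂ) • 1 + (θ : ℂ) • Matrix.diagonal fun x => (W x.1 : ℂ) :=
          by exact add_le_add hone htr
      _ = _ := by
          rw [Complex.ofReal_one, one_smul, ← Matrix.diagonal_one, ← Matrix.diagonal_smul,
            Matrix.diagonal_add]
          simp
  have hon : ∑ e, (expWeight θ B f (some e) : ℂ) • blockPOVM t η₁ η₂ (some e) =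
      onDetected (∑ e, (expWeight θ B f (some e) : ℂ) • detPOVM t η₁ η₂ e) := by
    simp only [Fintype.sum_sum_type, Fintype.sum_bool, onDetected_add, onDetected_smul,
      blockPOVM_some]
  rw [Fintype.sum_option, hon]
  refine (add_le_add_right (onDetected_mono hdet) _).trans ?_
  rw [onDetected_diagonal fun z => ((1 + θ * W z : ℝ) : ℂ), Matrix.le_iff, blockPOVM, notDetected,
    ← Matrix.diagonal_smul, Matrix.diagonal_add, Matrix.diagonal_sub]
  refine Matrix.PosSemidef.diagonal fun x => ?_
  rw [Pi.zero_apply]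
  by_cases hx : x.2 = none
  · have : (0 : ℂ) ≤ ((θ * W x.1 : ℝ) : ℂ) := Complex.zero_le_real.2 (mul_nonneg hθ (hW _))
    simpa [hx, expWeight] using this
  · simp [hx]

section State
variable {M K E : Type*} [NormedAddCommGroup E] [InnerProductSpace ℂ E] {N : ℕ}
  {t η₁ η₂ : ℝ} (ψ : Fin 3 → Bool → FockR M K) (V : Attack N M E)

theorem prob_nonneg (ht0 : 0 ≤ t) (ht1 : t ≤ 1) (h0 : 0 ≤ η₁) (h1 : η₁ ≤ 1) (h0' : 0 ≤ η₂)
    (h1' : η₂ ≤ 1) (o : Fin N → Outcome) : 0 ≤ prob t η₁ η₂ ψ V o :=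
  expect_nonneg ψ V (piTensor_posSemidef fun k => blockPOVM_posSemidef ht0 ht1 h0 h1 h0' h1' (o k))

theorem sum_prob_mul_prod (g : Outcome → ℝ) :
    ∑ o : Fin N → Outcome, prob t η₁ η₂ ψ V o * ∏ k, g (o k) =
      expect ψ V (piTensor fun _ => ∑ o, (g o : ℂ) • blockPOVM t η₁ η₂ o) := by
  have h1 : (piTensor fun _ : Fin N => ∑ o, (g o : ℂ) • blockPOVM t η₁ η₂ o) =
      ∑ o : Fin N → Outcome, ((∏ k, g (o k) : ℝ) : ℂ) • prodPOVM t η₁ η₂ o := by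
    ext x y
    simp only [piTensor, Matrix.sum_apply, Matrix.smul_apply, smul_eq_mul, prodPOVM]
    rw [Finset.prod_univ_sum, Fintype.piFinset_univ]
    refine Finset.sum_congr rfl fun o _ => ?_
    rw [Finset.prod_mul_distrib]
    push_cast
    rfl
  rw [h1, expect, Finset.sum_mul, Matrix.trace_sum, Complex.re_sum]
  refine Finset.sum_congr rfl fun o _ => ?_
  rw [Matrix.smul_mul, Matrix.trace_smul, smul_eq_mul, Complex.re_ofReal_mul, mul_comm]
  rfl

/-- The exponential moment bound against coherent attacks. One operator inequality per block
suffices, because tensor products of positive operators are monotone and Alice's outcomes in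
different blocks are independent. -/
theorem sum_prob_mul_prod_expWeight_le {ρ : Fin 3 → Bool → (Fock M →L[ℂ] Fock M)} {q : ℕ → ℝ}
    {ψ : Fin 3 → Bool → FockR M K} (hψ : IsPurification ψ ρ) (hρ : IsSource ρ q)
    (V : Attack N M E) {θ B : ℝ} (ht0 : 0 ≤ t) (ht1 : t ≤ 1) (h0 : 0 ≤ η₁)
    (h1 : η₁ ≤ 1) (h0' : 0 ≤ η₂) (h1' : η₂ ≤ 1) (hθ : 0 ≤ θ) {f : Bool ⊕ Bool → ℝ}
    (hf : ∀ e, |f e| ≤ B) (hB : θ * B ≤ 1) {W : (Fin 3 → Bool) → ℝ} (hW : ∀ z, 0 ≤ W z)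
    (hfW : ∑ e, (f e : ℂ) • detPOVM t η₁ η₂ e ≤ Matrix.diagonal fun x => (W x.1 : ℂ)) :
    ∑ o, prob t η₁ η₂ ψ V o * ∏ k, expWeight θ B f (o k) ≤
      Real.exp (θ * (∑ z, W z * zProb ψ z) * N) := by
  rw [sum_prob_mul_prod]
  refine (expect_mono ψ V (piTensor_mono (fun _ => Matrix.posSemidef_sum _ fun o _ =>
    (blockPOVM_posSemidef ht0 ht1 h0 h1 h0' h1' o).smul
      (Complex.zero_le_real.2 (expWeight_nonneg θ B f o)))
    fun _ => sum_expWeight_smul_le ht0 ht1 h0 h1 h0' h1' hθ hf hB hW hfW)).trans ?_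
  have hd : (piTensor fun _ : Fin N => Matrix.diagonal fun x : Blk => ((1 + θ * W x.1 : ℝ) : ℂ)) =
      Matrix.diagonal fun x => ((∏ k, (1 + θ * W (x k).1) : ℝ) : ℂ) := by
    ext x y
    rw [piTensor, Matrix.diagonal_apply]
    split_ifs with h
    · subst h
      simp
    · obtain ⟨k, hk⟩ := Function.ne_iff.1 h
      exact Finset.prod_eq_zero (Finset.mem_univ k) (Matrix.diagonal_apply_ne _ hk)
  rw [hd, expect_diagonal ψ V fun z => ∏ k, (1 + θ * W (z k))]
  have hp : ∑ z : Fin N → Fin 3 → Bool, (∏ k, (1 + θ * W (z k))) *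
      ∏ k, ∏ i, pulseProb (ψ i) (z k i) = (1 + θ * ∑ z, W z * zProb ψ z) ^ N := by
    have h2 := Finset.prod_univ_sum (fun _ : Fin N => (Finset.univ : Finset (Fin 3 → Bool)))
      fun _ z => (1 + θ * W z) * zProb ψ z
    rw [Fintype.piFinset_univ, Finset.prod_const, Finset.card_fin] at h2
    have h3 : ∑ z, (1 + θ * W z) * zProb ψ z = 1 + θ * ∑ z, W z * zProb ψ z := by
      simp only [add_mul, one_mul, Finset.sum_add_distrib, hψ.sum_zProb hρ, Finset.mul_sum,
        mul_assoc]
    rw [← h3, h2]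
    exact Finset.sum_congr rfl fun z _ => Finset.prod_mul_distrib.symm
  rw [hp, mul_comm _ (N : ℝ), Real.exp_nat_mul]
  have hw : 0 ≤ ∑ z, W z * zProb ψ z :=
    Finset.sum_nonneg fun z _ => mul_nonneg (hW z) (zProb_nonneg z)
  refine pow_le_pow_left₀ (by positivity) ?_ N
  linarith [Real.add_one_le_exp (θ * ∑ z, W z * zProb ψ z)]

end State

/-! ### Counting the outcomes -/

/-- The sum over the detected blocks of a score assigned to the four possible outcomes. -/
def score {N : ℕ} (f : Bool ⊕ Bool → ℝ) (o : Fin N → Outcome) : ℝ :=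
  f (.inl true) * nPh o + f (.inl false) * (nCode o - nPh o) + f (.inr true) * nBit o +
    f (.inr false) * (nSample o - nBit o)

open Classical in
theorem ncard_eq_sum {N : ℕ} (P : Fin N → Prop) :
    (({k | P k} : Set (Fin N)).ncard : ℝ) = ∑ k, if P k then (1 : ℝ) else 0 := by
  rw [Set.ncard_eq_toFinset_card', Finset.sum_boole]
  simp

theorem nDet_eq {N : ℕ} (o : Fin N → Outcome) : (nDet o : ℝ) = nCode o + nSample o := by
  simp only [nDet, nCode, nSample, ncard_eq_sum, ← Finset.sum_add_distrib]
  refine Finset.sum_congr rfl fun k _ => ?_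
  rcases o k with _ | (_ | _) | (_ | _) <;> simp

theorem nPh_le_nCode {N : ℕ} (o : Fin N → Outcome) : (nPh o : ℝ) ≤ nCode o :=
  Nat.cast_le.2 (Set.ncard_le_ncard fun _ hk => ⟨_, hk⟩)

theorem nBit_le_nSample {N : ℕ} (o : Fin N → Outcome) : (nBit o : ℝ) ≤ nSample o :=
  Nat.cast_le.2 (Set.ncard_le_ncard fun _ hk => ⟨_, hk⟩)

theorem prod_expWeight {N : ℕ} (θ B : ℝ) (f : Bool ⊕ Bool → ℝ) (o : Fin N → Outcome) :
    ∏ k, expWeight θ B f (o k) = Real.exp (θ * score f o - (θ * B) ^ 2 * nDet o) := by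
  have h : ∀ k, expWeight θ B f (o k) = Real.exp
      (match o k with | none => 0 | some e => θ * f e - (θ * B) ^ 2) := by
    intro k
    rcases o k with _ | e <;> simp [expWeight]
  simp only [h, ← Real.exp_sum]
  congr 1
  simp only [score, nDet, nCode, nSample, nPh, nBit, ncard_eq_sum, ← Finset.sum_sub_distrib,
    Finset.mul_sum, ← Finset.sum_add_distrib]
  refine Finset.sum_congr rfl fun k _ => ?_
  rcases o k with _ | (_ | _) | (_ | _) <;> simp

section State
variable {M K E : Type*} [NormedAddCommGroup E] [InnerProductSpace ℂ E] {N : ℕ}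
  {t η₁ η₂ : ℝ} {ψ : Fin 3 → Bool → FockR M K}

theorem Pr_le_add (V : Attack N M E) (ht0 : 0 ≤ t) (ht1 : t ≤ 1) (h0 : 0 ≤ η₁) (h1 : η₁ ≤ 1)
    (h0' : 0 ≤ η₂) (h1' : η₂ ≤ 1) {A A₁ A₂ : Set (Fin N → Outcome)} (h : A ⊆ A₁ ∪ A₂) :
    Pr t η₁ η₂ ψ V A ≤ Pr t η₁ η₂ ψ V A₁ + Pr t η₁ η₂ ψ V A₂ := by
  classical
  have hp := prob_nonneg ψ V ht0 ht1 h0 h1 h0' h1'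
  simp only [Pr, Finset.sum_filter, ← Finset.sum_add_distrib]
  refine Finset.sum_le_sum fun o _ => ?_
  by_cases hA : o ∈ A
  · rcases h hA with h2 | h2
    · rw [if_pos hA, if_pos h2]
      split_ifs <;> linarith [hp o]
    · rw [if_pos hA, if_pos h2]
      split_ifs <;> linarith [hp o]
  · rw [if_neg hA]
    split_ifs <;> linarith [hp o]

/-- Markov's inequality for the exponential moment. -/
theorem Pr_score_le {ρ : Fin 3 → Bool → (Fock M →L[ℂ] Fock M)} {q : ℕ → ℝ}
    (hψ : IsPurification ψ ρ) (hρ : IsSource ρ q)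
    (V : Attack N M E) {θ B : ℝ} (ht0 : 0 ≤ t) (ht1 : t ≤ 1) (h0 : 0 ≤ η₁)
    (h1 : η₁ ≤ 1) (h0' : 0 ≤ η₂) (h1' : η₂ ≤ 1) (hθ : 0 ≤ θ) {f : Bool ⊕ Bool → ℝ}
    (hf : ∀ e, |f e| ≤ B) (hB : θ * B ≤ 1) {W : (Fin 3 → Bool) → ℝ} (hW : ∀ z, 0 ≤ W z)
    (hfW : ∑ e, (f e : ℂ) • detPOVM t η₁ η₂ e ≤ Matrix.diagonal fun x => (W x.1 : ℂ))
    {d w : ℝ} (hd : 0 ≤ d) (hθd : θ * B ^ 2 ≤ d / 2) (m : ℕ) :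
    Pr t η₁ η₂ ψ V {o | m ≤ nDet o ∧ d * nDet o + w * N ≤ score f o} ≤
      Real.exp (θ * (∑ z, W z * zProb ψ z - w) * N - θ * d / 2 * m) := by
  classical
  have hp := prob_nonneg ψ V ht0 ht1 h0 h1 h0' h1'
  have hE := sum_prob_mul_prod_expWeight_le hψ hρ V ht0 ht1 h0 h1 h0' h1' hθ hf hB hW hfW
  set L := θ * w * N + θ * d / 2 * m with hL
  have hle : Pr t η₁ η₂ ψ V {o | m ≤ nDet o ∧ d * nDet o + w * N ≤ score f o} * Real.exp L ≤
      ∑ o, prob t η₁ η₂ ψ V o * ∏ k, expWeight θ B f (o k) := by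
    rw [Pr, Finset.sum_mul, Finset.sum_filter]
    refine Finset.sum_le_sum fun o _ => ?_
    rw [prod_expWeight]
    split_ifs with ho
    · obtain ⟨hm, hs⟩ := ho
      refine mul_le_mul_of_nonneg_left (Real.exp_le_exp.2 ?_) (hp o)
      have hm' : (m : ℝ) ≤ nDet o := Nat.cast_le.2 hm
      have k1 := mul_le_mul_of_nonneg_left hs hθ
      have k2 : (θ * B) ^ 2 * nDet o ≤ θ * d / 2 * nDet o := by
        refine mul_le_mul_of_nonneg_right ?_ (Nat.cast_nonneg _)
        nlinarith
      have k3 : θ * d / 2 * m ≤ θ * d / 2 * nDet o := mul_le_mul_of_nonneg_left hm' (by positivity)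
      rw [hL]
      linarith
    · exact mul_nonneg (hp o) (Real.exp_pos _).le
  have h2 := hle.trans hE
  rw [← le_div_iff₀ (Real.exp_pos L), ← Real.exp_sub] at h2
  refine h2.trans (Real.exp_le_exp.2 (le_of_eq ?_))
  rw [hL]
  ring

/-- The mean of `zWeight`; `c` weighs the one-photon against the three-photon blocks. -/
theorem sum_zWeight_mul_zProb_le {ρ : Fin 3 → Bool → (Fock M →L[ℂ] Fock M)} {q : ℕ → ℝ}
    (hψ : IsPurification ψ ρ) (hρ : IsSource ρ q) {l c : ℝ} (hl : 0 ≤ l) (hc : 0 < c) :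
    ∑ z, zWeight l c z * zProb ψ z ≤ l * ((c * q 1 + c⁻¹ * q 3) / 2) + q 2 := by
  have h1 := hψ.sum_zProb_le hρ (n := 1) le_rfl (by norm_num)
  have h2 := hψ.sum_zProb_le hρ (n := 2) (by norm_num) (by norm_num)
  have h3 := hψ.sum_zProb_le hρ (n := 3) (by norm_num) le_rfl
  have hci : 0 < c⁻¹ := inv_pos.2 hc
  calc ∑ z, zWeight l c z * zProb ψ z
      ≤ ∑ z, (l / 2 * (c * (if 1 ≤ numOnes z then zProb ψ z else 0) +
          c⁻¹ * if 3 ≤ numOnes z then zProb ψ z else 0) +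
          if 2 ≤ numOnes z then zProb ψ z else 0) := by
        refine Finset.sum_le_sum fun z _ => ?_
        have hz := zProb_nonneg (ψ := ψ) z
        have hle : (if numOnes z = 1 then c else 0) * zProb ψ z ≤
            c * if 1 ≤ numOnes z then zProb ψ z else 0 := by
          split_ifs with h h' h'
          · exact le_rfl
          · omega
          · rw [zero_mul]; positivity
          · simp
        have hle' : (if numOnes z = 3 then c⁻¹ else 0) * zProb ψ z ≤
            c⁻¹ * if 3 ≤ numOnes z then zProb ψ z else 0 := by
          split_ifs with h h' h'
          · exact le_rfl
          · omega
          · rw [zero_mul]; positivity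
          · simp
        have he : (if 2 ≤ numOnes z then (1 : ℝ) else 0) * zProb ψ z =
            if 2 ≤ numOnes z then zProb ψ z else 0 := by
          split_ifs <;> simp
        rw [zWeight, add_mul, he, mul_assoc, add_mul]
        have := mul_le_mul_of_nonneg_left (add_le_add hle hle') (by positivity : 0 ≤ l / 2)
        linarith
    _ = l / 2 * (c * (∑ z with 1 ≤ numOnes z, zProb ψ z) +
          c⁻¹ * ∑ z with 3 ≤ numOnes z, zProb ψ z) + ∑ z with 2 ≤ numOnes z, zProb ψ z := by
        simp only [Finset.sum_filter, Finset.mul_sum, Finset.sum_add_distrib, mul_add]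
    _ ≤ l / 2 * (c * q 1 + c⁻¹ * q 3) + q 2 := by gcongr
    _ = _ := by ring

end State

/-! ### From scores to error rates -/

/-- The weight in the inequality of arithmetic and geometric means can be optimized up to any
error; the optimum need not be attained when `a` or `b` vanishes. -/
theorem exists_weight_le_sqrt_add {a b s : ℝ} (ha : 0 ≤ a) (hb : 0 ≤ b) (hs : 0 < s) :
    ∃ c : ℝ, 0 < c ∧ (c * a + c⁻¹ * b) / 2 ≤ √(a * b) + s := by
  rcases ha.eq_or_lt with rfl | ha'
  · refine ⟨(b + 1) / (2 * s), by positivity, ?_⟩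
    rw [inv_div, zero_mul, Real.sqrt_zero, mul_zero, zero_add, zero_add, div_mul_eq_mul_div,
      div_div, div_le_iff₀ (by positivity)]
    nlinarith
  rcases hb.eq_or_lt with rfl | hb'
  · refine ⟨2 * s / (a + 1), by positivity, ?_⟩
    rw [mul_zero, mul_zero, Real.sqrt_zero, add_zero, zero_add, div_mul_eq_mul_div, div_div,
      div_le_iff₀ (by positivity)]
    nlinarith
  · obtain ⟨u, hu, rfl⟩ : ∃ u > 0, a = u ^ 2 := ⟨√a, Real.sqrt_pos.2 ha', (Real.sq_sqrt ha).symm⟩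
    obtain ⟨v, hv, rfl⟩ : ∃ v > 0, b = v ^ 2 := ⟨√b, Real.sqrt_pos.2 hb', (Real.sq_sqrt hb).symm⟩
    refine ⟨v / u, by positivity, ?_⟩
    have h : (v / u * u ^ 2 + (v / u)⁻¹ * v ^ 2) / 2 = u * v := by
      field_simp
      ring
    rw [h, ← mul_pow, Real.sqrt_sq (by positivity)]
    linarith

/-- The score whose concentration bounds the phase error rate. -/
def phaseScore (t l δ₂ : ℝ) : Bool ⊕ Bool → ℝ
  | .inl true => 1 / t - 2 * l * δ₂
  | .inl false => -(2 * l * δ₂)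
  | .inr true => -(l / (1 - t)) - 2 * l * δ₂
  | .inr false => -(2 * l * δ₂)

/-- The score whose concentration bounds the number of code events from below. -/
def codeScore (t : ℝ) : Bool ⊕ Bool → ℝ
  | .inl _ => t - 1
  | .inr _ => t

theorem sum_codeScore_smul_detPOVM_le (t η₁ η₂ : ℝ) :
    ∑ e, (codeScore t e : ℂ) • detPOVM t η₁ η₂ e ≤
      Matrix.diagonal fun x => (((fun _ => 0) x.1 : ℝ) : ℂ) := by
  rw [sum_smul_detPOVM]
  have : t * (t - 1) + (1 - t) * t = 0 := by ring
  simp [codeScore, this]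

theorem sum_phaseScore_smul_detPOVM_le {t η₁ η₂ δ₁ δ₂ c : ℝ} (ht0 : 0 < t) (ht1 : t < 1)
    (hδ₁ : 0 ≤ δ₁) (hδ₁' : δ₁ < 1 / 2) (hδ₂ : 0 ≤ δ₂) (hδ₂' : δ₂ < 1 / 2)
    (h₁ : η₁ ∈ Set.Icc (1 / 2 - δ₁) (1 / 2 + δ₁)) (h₂ : η₂ ∈ Set.Icc (1 / 2 - δ₂) (1 / 2 + δ₂))
    (hc : 0 < c) :
    ∑ e, (phaseScore t (lam (1 / 2 + δ₁) (1 / 2 + δ₂)) δ₂ e : ℂ) • detPOVM t η₁ η₂ e ≤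
      Matrix.diagonal fun x => (zWeight (lam (1 / 2 + δ₁) (1 / 2 + δ₂)) c x.1 : ℂ) := by
  refine le_trans (le_of_eq ?_) (ePh_sub_le hδ₁ hδ₁' hδ₂ hδ₂' h₁ h₂ hc)
  set l := lam (1 / 2 + δ₁) (1 / 2 + δ₂)
  have ht1' : 0 < 1 - t := sub_pos.2 ht1
  rw [sum_smul_detPOVM]
  have e1 : t * (phaseScore t l δ₂ (.inl true) - phaseScore t l δ₂ (.inl false)) = 1 := by
    simp only [phaseScore]; field_simp; ring
  have e2 : (1 - t) * (phaseScore t l δ₂ (.inr true) -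
      phaseScore t l δ₂ (.inr false)) = -l := by
    simp only [phaseScore]; field_simp; ring
  have e3 : t * phaseScore t l δ₂ (.inl false) +
      (1 - t) * phaseScore t l δ₂ (.inr false) = -(2 * l * δ₂) := by
    simp only [phaseScore]; ring
  rw [e1, e2, e3, Complex.ofReal_neg, Complex.ofReal_neg, Complex.ofReal_one, one_smul,
    neg_smul, neg_smul, ← sub_eq_add_neg, ← sub_eq_add_neg]

/-- If the phase error rate exceeds the bound, then the numbers of outcomes deviate from what one
expects for the given state: either there are few code events, or the phase errors are not accounted
for by bit errors and multiphoton emissions. -/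
theorem score_of_phaseErrorBound_lt {N : ℕ} {t δ₁ δ₂ ε : ℝ} {q : ℕ → ℝ} (ht0 : 0 < t)
    (ht1 : t < 1) (hl : 0 ≤ lam (1 / 2 + δ₁) (1 / 2 + δ₂)) {e : ℝ} (he : 0 ≤ e)
    (heε : e * (1 / t + lam (1 / 2 + δ₁) (1 / 2 + δ₂) / (1 - t)) ≤ ε / 2)
    (o : Fin N → Outcome) (hn : 0 < nDet o)
    (h : phaseErrorBound δ₁ δ₂ q o + ε < phaseErrorRate o) :
    e * nDet o + 0 * N ≤ score (codeScore t) o ∨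
      ε / 2 * nDet o + (lam (1 / 2 + δ₁) (1 / 2 + δ₂) * √(q 1 * q 3) + q 2) * N ≤
        score (phaseScore t (lam (1 / 2 + δ₁) (1 / 2 + δ₂)) δ₂) o := by
  set l := lam (1 / 2 + δ₁) (1 / 2 + δ₂) with hl'
  have hn' : (0 : ℝ) < nDet o := Nat.cast_pos.2 hn
  have hcs := nDet_eq o
  have hs1 : score (codeScore t) o = t * nDet o - nCode o := by
    simp only [score, codeScore]; rw [hcs]; ring
  have hs2 : score (phaseScore t l δ₂) o =
      nPh o / t - l * (nBit o / (1 - t)) - 2 * l * δ₂ * nDet o := by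
    simp only [score, phaseScore]; rw [hcs]; ring
  rw [hs1, hs2]
  refine or_iff_not_imp_left.2 fun hcode => ?_
  push Not at hcode
  set x := phaseErrorRate o with hx
  set y := bitErrorRate o with hy
  have hph := nPh_le_nCode o
  have hbit := nBit_le_nSample o
  -- These hold without code or sample events, too: the rates are then `0 / 0 = 0`.
  have ex : (nPh o : ℝ) = x * nCode o := by
    rcases eq_or_ne (nCode o : ℝ) 0 with h0 | h0
    · rw [h0] at hph ⊢
      linarith [Nat.cast_nonneg (α := ℝ) (nPh o)]
    · rw [hx, phaseErrorRate, div_mul_cancel₀ _ h0]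
  have ey : (nBit o : ℝ) = y * nSample o := by
    rcases eq_or_ne (nSample o : ℝ) 0 with h0 | h0
    · rw [h0] at hbit ⊢
      linarith [Nat.cast_nonneg (α := ℝ) (nBit o)]
    · rw [hy, bitErrorRate, div_mul_cancel₀ _ h0]
  have hx0 : 0 ≤ x := div_nonneg (Nat.cast_nonneg _) (Nat.cast_nonneg _)
  have hx1 : x ≤ 1 := div_le_one_of_le₀ hph (Nat.cast_nonneg _)
  have hy0 : 0 ≤ y := div_nonneg (Nat.cast_nonneg _) (Nat.cast_nonneg _)
  have hy1 : y ≤ 1 := div_le_one_of_le₀ hbit (Nat.cast_nonneg _)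
  have ht1' : 0 < 1 - t := sub_pos.2 ht1
  have hP : x * nDet o - e / t * nDet o ≤ nPh o / t := by
    rw [le_div_iff₀ ht0, ex, sub_mul, div_mul_eq_mul_div, div_mul_cancel₀ _ ht0.ne']
    nlinarith [mul_nonneg (mul_nonneg he hn'.le) (sub_nonneg.2 hx1)]
  have hB : nBit o / (1 - t) ≤ y * nDet o + e / (1 - t) * nDet o := by
    rw [div_le_iff₀ ht1', ey, add_mul, div_mul_eq_mul_div, div_mul_cancel₀ _ ht1'.ne']
    have : (nSample o : ℝ) ≤ (1 - t) * nDet o + e * nDet o := by linarith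
    nlinarith [mul_nonneg (mul_nonneg he hn'.le) (sub_nonneg.2 hy1),
      mul_le_mul_of_nonneg_left this hy0]
  have hmain : (l * (y + 2 * δ₂) + ε) * nDet o + (l * √(q 1 * q 3) + q 2) * N ≤ x * nDet o := by
    have h1 := mul_le_mul_of_nonneg_right h.le hn'.le
    have h2 : ∀ a : ℝ, a / detRate o * nDet o = a * N := fun a => by
      rw [detRate, div_div_eq_mul_div, div_mul_cancel₀ _ hn'.ne']
    rw [phaseErrorBound, ← hl', ← hy] at h1
    have h3 := h2 (√(q 1 * q 3))
    have h4 := h2 (q 2)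
    linear_combination h1 - l * h3 - h4
  have hlB := mul_le_mul_of_nonneg_left hB hl
  have hε := mul_le_mul_of_nonneg_right heε hn'.le
  have hε' : e * (1 / t + l / (1 - t)) * nDet o =
      e / t * nDet o + l * (e / (1 - t) * nDet o) := by ring
  linarith

theorem exists_nat_exp_le {C k p : ℝ} (hk : 0 < k) (hp : 0 < p) :
    ∃ m₀ : ℕ, ∀ m ≥ m₀, Real.exp (C - k * (m : ℕ)) ≤ p := by
  have h : Filter.Tendsto (fun m : ℕ => Real.exp (C - k * m)) Filter.atTop (nhds 0) :=
    Real.tendsto_exp_atBot.comp (Filter.tendsto_atBot_add_const_left _ _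
      (Filter.tendsto_neg_atTop_atBot.comp
        (tendsto_natCast_atTop_atTop.const_mul_atTop hk)))
  exact Filter.eventually_atTop.1 (h.eventually_le_const hp)

end DPS

end

theorem theorem3 (t δ₁ δ₂ : ℝ) (q : ℕ → ℝ) (ht0 : 0 < t) (ht1 : t < 1)
    (hδ₁ : 0 ≤ δ₁) (hδ₁' : δ₁ < 1 / 2) (hδ₂ : 0 ≤ δ₂) (hδ₂' : δ₂ < 1 / 2) :
    (∀ (M : Type*) (ρ : Fin 3 → Bool → (DPS.Fock M →L[ℂ] DPS.Fock M)), DPS.IsSource ρ q →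
      ∃ ψ : Fin 3 → Bool → DPS.FockR M (DPS.Occ M), DPS.IsPurification ψ ρ) ∧
    ∀ ε > 0, ∀ p > 0, ∃ m : ℕ,
      ∀ η₁ ∈ Set.Icc (1 / 2 - δ₁) (1 / 2 + δ₁), ∀ η₂ ∈ Set.Icc (1 / 2 - δ₂) (1 / 2 + δ₂),
      ∀ (M K E : Type*) [NormedAddCommGroup E] [InnerProductSpace ℂ E]
        (ρ : Fin 3 → Bool → (DPS.Fock M →L[ℂ] DPS.Fock M)) (ψ : Fin 3 → Bool → DPS.FockR M K),
        DPS.IsSource ρ q → DPS.IsPurification ψ ρ →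
        ∀ (N : ℕ) (V : DPS.Attack N M E),
          DPS.Pr t η₁ η₂ ψ V {o | m ≤ DPS.nDet o ∧
            DPS.phaseErrorBound δ₁ δ₂ q o + ε < DPS.phaseErrorRate o} ≤ p := by
  refine ⟨fun M ρ h => DPS.exists_isPurification h, fun ε hε p hp => ?_⟩
  have hl2 : 2 ≤ DPS.lam (1 / 2 + δ₁) (1 / 2 + δ₂) := by
    have := (DPS.lam_half_spec (h := 1 / 2 + δ₁) (h₂ := 1 / 2 + δ₂) (by linarith)
      (by linarith) (by linarith) (by linarith)).1
    linarith
  set l := DPS.lam (1 / 2 + δ₁) (1 / 2 + δ₂) with hl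
  have hl0 : 0 < l := by linarith
  have ht1' : 0 < 1 - t := sub_pos.2 ht1
  have hlt : 0 < l / (1 - t) := div_pos hl0 ht1'
  have ht0' : 0 < 1 / t := by positivity
  have hlδ : 0 ≤ 2 * l * δ₂ := by positivity
  -- `e` is the tolerated relative deviation of the number of code events.
  obtain ⟨e, he, heε⟩ : ∃ e > 0, e * (1 / t + l / (1 - t)) ≤ ε / 2 :=
    ⟨ε / 2 / (1 / t + l / (1 - t)), by positivity, (div_mul_cancel₀ _ (by positivity)).le⟩
  set B := 1 / t + l / (1 - t) + 2 * l * δ₂ with hB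
  have hB0 : 0 < B := by positivity
  -- The second-order term `(θ B)²` per detected block has to stay below half of the gain `θ d`.
  have hθ : ∀ {B d : ℝ}, 0 < B → 0 < d → ∃ θ > 0, θ * B ≤ 1 ∧ θ * B ^ 2 ≤ d / 2 := by
    intro B d hB hd
    refine ⟨min (1 / B) (d / (2 * B ^ 2)), lt_min (by positivity) (by positivity), ?_, ?_⟩
    · exact (mul_le_mul_of_nonneg_right (min_le_left _ _) hB.le).trans
        (div_mul_cancel₀ _ hB.ne').le
    · refine (mul_le_mul_of_nonneg_right (min_le_right _ _) (sq_nonneg B)).trans (le_of_eq ?_)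
      field_simp
  obtain ⟨θ₁, hθ₁, hθ₁B, hθ₁e⟩ := hθ one_pos he
  obtain ⟨θ₂, hθ₂, hθ₂B, hθ₂e⟩ := hθ hB0 (half_pos hε)
  obtain ⟨m₁, hm₁⟩ := DPS.exists_nat_exp_le (C := 0) (k := θ₁ * e / 2) (by positivity) (half_pos hp)
  obtain ⟨m₂, hm₂⟩ := DPS.exists_nat_exp_le (C := 1) (k := θ₂ * (ε / 2) / 2) (by positivity)
    (half_pos hp)
  refine ⟨max 1 (max m₁ m₂), fun η₁ h₁ η₂ h₂ M K E _ _ ρ ψ hρ hψ N V => ?_⟩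
  set m := max 1 (max m₁ m₂)
  have hm1 : m₁ ≤ m := (le_max_left _ _).trans (le_max_right _ _)
  have hm2 : m₂ ≤ m := (le_max_right _ _).trans (le_max_right _ _)
  have h0 : 0 ≤ η₁ := by linarith [h₁.1]
  have h1 : η₁ ≤ 1 := by linarith [h₁.2]
  have h0' : 0 ≤ η₂ := by linarith [h₂.1]
  have h1' : η₂ ≤ 1 := by linarith [h₂.2]
  have hq : ∀ n, 1 ≤ n → n ≤ 3 → 0 ≤ q n := fun n k1 k3 =>
    (Finset.sum_nonneg fun z _ => DPS.zProb_nonneg z).trans (hψ.sum_zProb_le hρ k1 k3)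
  refine (DPS.Pr_le_add (A₁ := {o | m ≤ DPS.nDet o ∧ e * DPS.nDet o + 0 * N ≤
      DPS.score (DPS.codeScore t) o})
    (A₂ := {o | m ≤ DPS.nDet o ∧ ε / 2 * DPS.nDet o + (l * √(q 1 * q 3) + q 2) * N ≤
      DPS.score (DPS.phaseScore t l δ₂) o}) V ht0.le ht1.le h0 h1 h0' h1' ?_).trans ?_
  · rintro o ⟨ho, hlt⟩
    rcases DPS.score_of_phaseErrorBound_lt ht0 ht1 hl0.le he.le heε o
      (lt_of_lt_of_le one_pos ((le_max_left _ _).trans ho)) hlt with h | h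
    · exact Or.inl ⟨ho, h⟩
    · exact Or.inr ⟨ho, h⟩
  rw [← add_halves p]
  refine add_le_add ?_ ?_
  · refine (DPS.Pr_score_le (θ := θ₁) (B := 1) (W := fun _ => 0) hψ hρ V ht0.le ht1.le h0 h1 h0' h1'
      hθ₁.le (fun e => ?_) hθ₁B (fun _ => le_rfl) (DPS.sum_codeScore_smul_detPOVM_le t η₁ η₂)
      he.le hθ₁e m).trans ?_
    · rcases e with _ | _ <;> simp only [DPS.codeScore, abs_le] <;> constructor <;> linarith
    · refine (Real.exp_le_exp.2 (le_of_eq ?_)).trans (hm₁ m hm1)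
      simp
  · -- The weight is optimal up to an error that costs at most a factor `exp 1`.
    obtain ⟨c, hc, hcq⟩ := DPS.exists_weight_le_sqrt_add (hq 1 le_rfl (by norm_num))
      (hq 3 (by norm_num) le_rfl) (s := 1 / (θ₂ * l * (N + 1))) (by positivity)
    refine (DPS.Pr_score_le (θ := θ₂) (B := B) (W := DPS.zWeight l c) hψ hρ V ht0.le ht1.le h0 h1
      h0' h1' hθ₂.le (fun e => ?_) hθ₂B (fun z => ?_)
      (DPS.sum_phaseScore_smul_detPOVM_le ht0 ht1 hδ₁ hδ₁' hδ₂ hδ₂' h₁ h₂ hc) (half_pos hε).le hθ₂e m).trans ?_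
    · rcases e with (_ | _) | (_ | _) <;> simp only [DPS.phaseScore, abs_le, hB] <;>
        constructor <;> linarith
    · have := inv_pos.2 hc
      rw [DPS.zWeight]
      split_ifs <;> positivity
    · refine (Real.exp_le_exp.2 (sub_le_sub_right ?_ _)).trans (hm₂ m hm2)
      have hw := DPS.sum_zWeight_mul_zProb_le hψ hρ hl0.le hc
      have hw2 := mul_le_mul_of_nonneg_left hcq hl0.le
      have hw3 : ∑ z, DPS.zWeight l c z * DPS.zProb ψ z - (l * √(q 1 * q 3) + q 2) ≤
          l * (1 / (θ₂ * l * (N + 1))) := by linarith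
      calc θ₂ * (∑ z, DPS.zWeight l c z * DPS.zProb ψ z - (l * √(q 1 * q 3) + q 2)) * N
          ≤ θ₂ * (l * (1 / (θ₂ * l * (N + 1)))) * N := by gcongr
        _ = N / (N + 1) := by field_simp
        _ ≤ 1 := div_le_one_of_le₀ (by linarith) (by positivity)
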